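/- Let $A_1$ be the single-mode complex Weyl algebra, i.e. the unital associative $\mathbb{C}$-algebra generated by $a$ and $a^\dagger$ with the single relation $aa^\dagger-a^\dagger a=1$, and let $p\mapsto p^\dagger$ be the conjugate-linear anti-automorphism of $A_1$ that exchanges $a$ and $a^\dagger$. Let $\hat{A}_1=\{p\in A_1: p^\dagger=-p\}$ be the skew-hermitian Weyl algebra, regarded as a real Lie algebra with bracket $[p,q]=pq-qp$. Let $\mathfrak{g}$ be a non-abelian finite-dimensional real Lie subalgebra of $\hat{A}_1$ that contains the free Hamiltonian term $i(a^\dagger a+c)$ for some $c\in\mathbb{R}$. Then $\mathfrak{g}$ is isomorphic, as a real Lie algebra, to one of the following four Lie algebras: (a) the Schrödinger algebra $\mathcal{S}=\mathfrak{sl}(2,\mathbb{R})\ltimes\mathfrak{h}_1$, where $\mathfrak{h}_1$ is the real Heisenberg algebra with basis $q,p,z$, $[q,p]=z$ and $z$ central, and where $\mathfrak{sl}(2,\mathbb{R})$ acts on $\operatorname{span}\{q,p\}$ by its standard two-dimensional representation and trivially on $z$ (that is, for the basis $h,x,y$ with $[h,x]=2x$, $[h,y]=-2y$, $[x,y]=h$,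 one has $[h,q]=q$, $[h,p]=-p$, $[x,q]=0$, $[x,p]=q$, $[y,q]=p$, $[y,p]=0$); (b) the direct sum $\mathfrak{sl}(2,\mathbb{R})\oplus\mathbb{R}$ with the one-dimensional abelian Lie algebra $\mathbb{R}$; (c) the special linear algebra $\mathfrak{sl}(2,\mathbb{R})$; (d) the Wigner-Heisenberg algebra $\mathfrak{wh}_2$, i.e. the solvable four-dimensional real Lie algebra with basis $h,q,p,z$ and brackets $[h,q]=-p$, $[h,p]=q$, $[q,p]=z$, $z$ central. -/

import Mathlib

noncomputable section

namespace SingleMode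

/-- The canonical commutation relation `a a† = a† a + 1`, imposed on the free complex algebra on two
letters; `false` stands for the annihilation operator `a`, `true` for the creation operator `a†`. -/
inductive CCR : FreeAlgebra ℂ Bool → FreeAlgebra ℂ Bool → Prop
  | comm : CCR (FreeAlgebra.ι ℂ false * FreeAlgebra.ι ℂ true)
      (FreeAlgebra.ι ℂ true * FreeAlgebra.ι ℂ false + 1)

/-- The single-mode complex Weyl algebra `A₁`: the associative unital complex algebra generated by
`a` and `a†` with the single relation `[a, a†] = 1`. -/
def WeylAlgebra : Type := RingQuot CCR

namespace WeylAlgebra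

instance : Ring WeylAlgebra := inferInstanceAs (Ring (RingQuot CCR))

instance : Algebra ℂ WeylAlgebra := inferInstanceAs (Algebra ℂ (RingQuot CCR))

/-- The generators: `gen false = a` and `gen true = a†`. -/
def gen (b : Bool) : WeylAlgebra := RingQuot.mkAlgHom ℂ CCR (FreeAlgebra.ι ℂ b)

/-- The annihilation operator `a`. -/
def ann : WeylAlgebra := gen false

/-- The creation operator `a†`. -/
def cre : WeylAlgebra := gen true

theorem ann_mul_cre : ann * cre = cre * ann + 1 := by
  have h := RingQuot.mkAlgHom_rel ℂ CCR.comm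
  rw [map_mul, map_add, map_mul, map_one] at h
  exact h

theorem induction {P : WeylAlgebra → Prop} (hs : ∀ c : ℂ, P (algebraMap ℂ WeylAlgebra c))
    (hg : ∀ b, P (gen b)) (hm : ∀ x y, P x → P y → P (x * y))
    (ha : ∀ x y, P x → P y → P (x + y)) (x : WeylAlgebra) : P x := by
  obtain ⟨y, rfl⟩ := RingQuot.mkAlgHom_surjective ℂ CCR x
  induction y using FreeAlgebra.induction with
  | grade0 c =>
    rw [AlgHom.commutes]
    exact hs c
  | grade1 b => exact hg b
  | mul x y hx hy =>
    rw [map_mul]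
    exact hm _ _ hx hy
  | add x y hx hy =>
    rw [map_add]
    exact ha _ _ hx hy

/-- The opposite of the Weyl algebra, with complex scalars acting through complex conjugation. -/
@[reducible] def conjAlgebra : Algebra ℂ WeylAlgebraᵐᵒᵖ :=
  ((algebraMap ℂ WeylAlgebraᵐᵒᵖ).comp (starRingEnd ℂ)).toAlgebra'
    fun c x => Algebra.commutes (starRingEnd ℂ c) x

/-- The dagger operation as a ring homomorphism to the opposite ring: it exchanges `a` and `a†` and
conjugates complex scalars. -/
def daggerHom : WeylAlgebra →+* WeylAlgebraᵐᵒᵖ :=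
  letI := conjAlgebra
  (RingQuot.liftAlgHom ℂ (s := CCR)
    ⟨FreeAlgebra.lift ℂ fun b => MulOpposite.op (gen !b), by
      rintro _ _ ⟨⟩
      rw [map_mul, map_add, map_mul, map_one, FreeAlgebra.lift_ι_apply, FreeAlgebra.lift_ι_apply,
        ← MulOpposite.op_mul, ← MulOpposite.op_mul, ← MulOpposite.op_one, ← MulOpposite.op_add]
      exact congrArg MulOpposite.op ann_mul_cre⟩).toRingHom

theorem daggerHom_gen (b : Bool) : daggerHom (gen b) = MulOpposite.op (gen !b) := by
  let := conjAlgebra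
  refine (RingQuot.liftAlgHom_mkAlgHom_apply (S := ℂ) (s := CCR) _ _ _).trans ?_
  exact FreeAlgebra.lift_ι_apply _ _

theorem daggerHom_algebraMap (c : ℂ) : daggerHom (algebraMap ℂ WeylAlgebra c) =
    MulOpposite.op (algebraMap ℂ WeylAlgebra (starRingEnd ℂ c)) := by
  let := conjAlgebra
  exact AlgHom.commutes (RingQuot.liftAlgHom ℂ (s := CCR) _) c

/-- The dagger operation `p ↦ p†` on `A₁`: the conjugate-linear anti-automorphism exchanging `a`
and `a†`. -/
instance : Star WeylAlgebra := ⟨fun x => (daggerHom x).unop⟩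

theorem star_gen (b : Bool) : star (gen b) = gen !b :=
  congrArg MulOpposite.unop (daggerHom_gen b)

theorem star_algebraMap (c : ℂ) : star (algebraMap ℂ WeylAlgebra c) =
    algebraMap ℂ WeylAlgebra (starRingEnd ℂ c) :=
  congrArg MulOpposite.unop (daggerHom_algebraMap c)

theorem star_mul_rev (x y : WeylAlgebra) : star (x * y) = star y * star x :=
  congrArg MulOpposite.unop (map_mul daggerHom x y)

theorem star_add_eq (x y : WeylAlgebra) : star (x + y) = star x + star y :=
  congrArg MulOpposite.unop (map_add daggerHom x y)

instance : StarRing WeylAlgebra where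
  star_mul := star_mul_rev
  star_add := star_add_eq
  star_involutive x := by
    induction x using induction with
    | hs c => rw [star_algebraMap, star_algebraMap, Complex.conj_conj]
    | hg b => rw [star_gen, star_gen, Bool.not_not]
    | hm x y hx hy => rw [star_mul_rev, star_mul_rev, hx, hy]
    | ha x y hx hy => rw [star_add_eq, star_add_eq, hx, hy]

instance : StarModule ℂ WeylAlgebra where
  star_smul c x := by
    rw [Algebra.smul_def, Algebra.smul_def, star_mul_rev, star_algebraMap, ← Algebra.commutes]
    rfl

theorem star_ann : star ann = cre := star_gen false

theorem star_cre : star cre = ann := star_gen true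

end WeylAlgebra

open WeylAlgebra

/-- The commutator bracket on `A₁`. -/
instance : LieRing WeylAlgebra := LieRing.ofAssociativeRing

/-- The one-dimensional abelian Lie algebra `ℝ`. -/
instance : LieRing ℝ := LieRing.ofAssociativeRing

/-- The skew-hermitian Weyl algebra `Â₁`: the real Lie algebra of all `p ∈ A₁` with `p† = -p`, with
the commutator as bracket. -/
def skewWeyl : LieSubalgebra ℝ WeylAlgebra where
  carrier := {p | star p = -p}
  add_mem' {p q} hp hq := by
    rw [Set.mem_ofPred_eq] at *
    rw [star_add, hp, hq, neg_add]
  zero_mem' := by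
    rw [Set.mem_ofPred_eq, star_zero, neg_zero]
  smul_mem' r p hp := by
    rw [Set.mem_ofPred_eq] at *
    rw [← Complex.coe_smul, star_smul, hp, smul_neg, Complex.star_def, Complex.conj_ofReal]
  lie_mem' {p q} hp hq := by
    have hp' : star p = -p := hp
    have hq' : star q = -q := hq
    change star ⁅p, q⁆ = -⁅p, q⁆
    rw [Ring.lie_def, star_sub, star_mul, star_mul, hp', hq', neg_mul_neg, neg_mul_neg, neg_sub]

/-- The free Hamiltonian term `i (a† a + c)`, for a real number `c`. -/
def freeHamiltonian (c : ℝ) : skewWeyl :=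
  ⟨Complex.I • (cre * ann + algebraMap ℂ WeylAlgebra c), by
    change star _ = -_
    rw [star_smul, star_add, star_mul, star_ann, star_cre, star_algebraMap, Complex.conj_ofReal,
      Complex.star_def, Complex.conj_I, neg_smul]⟩

/-- The real Heisenberg algebra `𝔥₁`, in coordinates with respect to the basis `q, p, z` (in this
order): `[q, p] = z`, and `z` is central. -/
def Heisenberg : Type := Fin 3 → ℝ

namespace Heisenberg

instance : AddCommGroup Heisenberg := inferInstanceAs (AddCommGroup (Fin 3 → ℝ))

instance : Module ℝ Heisenberg := inferInstanceAs (Module ℝ (Fin 3 → ℝ))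

theorem add_apply (u v : Heisenberg) (i : Fin 3) : (u + v) i = u i + v i := rfl

theorem sub_apply (u v : Heisenberg) (i : Fin 3) : (u - v) i = u i - v i := rfl

theorem smul_apply (r : ℝ) (u : Heisenberg) (i : Fin 3) : (r • u) i = r * u i := rfl

/-- The element `s q + t p + r z`. -/
def mk (s t r : ℝ) : Heisenberg := ![s, t, r]

theorem ext_coords {u v : Heisenberg} (h0 : u 0 = v 0) (h1 : u 1 = v 1) (h2 : u 2 = v 2) :
    u = v := by
  funext i
  fin_cases i
  exacts [h0, h1, h2]

theorem mk_zero (s t r : ℝ) : mk s t r 0 = s := rfl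

theorem mk_one (s t r : ℝ) : mk s t r 1 = t := rfl

theorem mk_two (s t r : ℝ) : mk s t r 2 = r := rfl

instance : Bracket Heisenberg Heisenberg := ⟨fun u v => mk 0 0 (u 0 * v 1 - u 1 * v 0)⟩

theorem lie_eq (u v : Heisenberg) : ⁅u, v⁆ = mk 0 0 (u 0 * v 1 - u 1 * v 0) := rfl

instance : LieRing Heisenberg where
  add_lie u v w := by
    apply ext_coords <;> simp only [lie_eq, add_apply, mk_zero, mk_one, mk_two] <;> ring
  lie_add u v w := by
    apply ext_coords <;> simp only [lie_eq, add_apply, mk_zero, mk_one, mk_two] <;> ring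
  lie_self u := by
    apply ext_coords
    · rfl
    · rfl
    · exact sub_eq_zero_of_eq (mul_comm _ _)
  leibniz_lie u v w := by
    apply ext_coords <;> simp only [lie_eq, add_apply, mk_zero, mk_one, mk_two] <;> ring

instance : LieAlgebra ℝ Heisenberg where
  lie_smul r u v := by
    apply ext_coords <;> simp only [lie_eq, smul_apply, mk_zero, mk_one, mk_two] <;> ring

end Heisenberg

/-- The real special linear Lie algebra `𝔰𝔩(2, ℝ)` of traceless real `2 × 2` matrices. -/
abbrev SL2 : Type := LieAlgebra.SpecialLinear.sl (Fin 2) ℝ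

theorem SL2.trace_zero (M : SL2) : M.val 0 0 + M.val 1 1 = 0 := by
  have h : Matrix.trace M.val = 0 := M.property
  rwa [Matrix.trace_fin_two] at h

/-- The standard representation of `𝔰𝔩(2, ℝ)` on the span of `q, p`, extended by zero on `z`. For the
usual basis `h = diag (1, -1)`, `x = E₁₂`, `y = E₂₁` this reads `[h, q] = q`, `[h, p] = -p`,
`[x, q] = 0`, `[x, p] = q`, `[y, q] = p`, `[y, p] = 0`. -/
def sl2Action : SL2 →ₗ⁅ℝ⁆ LieDerivation ℝ Heisenberg Heisenberg where
  toFun M :=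
    { toFun := fun u => Heisenberg.mk (M.val 0 0 * u 0 + M.val 0 1 * u 1)
        (M.val 1 0 * u 0 + M.val 1 1 * u 1) 0
      map_add' := fun u v => by
        apply Heisenberg.ext_coords <;>
          simp only [Heisenberg.add_apply, Heisenberg.mk_zero, Heisenberg.mk_one,
            Heisenberg.mk_two] <;> ring
      map_smul' := fun r u => by
        apply Heisenberg.ext_coords <;>
          simp only [Heisenberg.smul_apply, Heisenberg.mk_zero, Heisenberg.mk_one,
            Heisenberg.mk_two, RingHom.id_apply] <;> ring
      leibniz' := fun u v => by
        have h := M.trace_zero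
        apply Heisenberg.ext_coords <;>
          simp only [LinearMap.coe_mk, AddHom.coe_mk, Heisenberg.sub_apply, Heisenberg.lie_eq,
            Heisenberg.mk_zero, Heisenberg.mk_one, Heisenberg.mk_two]
        · ring
        · ring
        · linear_combination (u 1 * v 0 - u 0 * v 1) * h }
  map_add' M N := by
    ext u
    apply Heisenberg.ext_coords <;>
      simp [Heisenberg.add_apply, Heisenberg.mk_zero, Heisenberg.mk_one, Heisenberg.mk_two] <;> ring
  map_smul' r M := by
    ext u
    apply Heisenberg.ext_coords <;>
      simp [Heisenberg.smul_apply, Heisenberg.mk_zero, Heisenberg.mk_one, Heisenberg.mk_two] <;>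
      ring
  map_lie' {M N} := by
    ext u
    rw [LieDerivation.commutator_apply]
    apply Heisenberg.ext_coords <;>
      simp [Heisenberg.sub_apply, Heisenberg.mk_zero, Heisenberg.mk_one, Heisenberg.mk_two,
        Ring.lie_def, Matrix.mul_apply, Fin.sum_univ_two] <;> ring

/-- The real Schrödinger algebra `𝒮 = 𝔰𝔩(2, ℝ) ⋉ 𝔥₁`. -/
abbrev Schrodinger : Type := LieAlgebra.SemiDirectSum Heisenberg SL2 sl2Action

/-- The real Wigner-Heisenberg algebra (of the second kind) `𝔴𝔥₂`, in coordinates with respect to the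
basis `h, q, p, z` (in this order): `[h, q] = -p`, `[h, p] = q`, `[q, p] = z`, and `z` is central. -/
def WignerHeisenberg : Type := Fin 4 → ℝ

namespace WignerHeisenberg

instance : AddCommGroup WignerHeisenberg := inferInstanceAs (AddCommGroup (Fin 4 → ℝ))

instance : Module ℝ WignerHeisenberg := inferInstanceAs (Module ℝ (Fin 4 → ℝ))

theorem add_apply (u v : WignerHeisenberg) (i : Fin 4) : (u + v) i = u i + v i := rfl

theorem smul_apply (r : ℝ) (u : WignerHeisenberg) (i : Fin 4) : (r • u) i = r * u i := rfl

/-- The element `w h + s q + t p + r z`. -/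
def mk (w s t r : ℝ) : WignerHeisenberg := ![w, s, t, r]

theorem ext_coords {u v : WignerHeisenberg} (h0 : u 0 = v 0) (h1 : u 1 = v 1) (h2 : u 2 = v 2)
    (h3 : u 3 = v 3) : u = v := by
  funext i
  fin_cases i
  exacts [h0, h1, h2, h3]

theorem mk_zero (w s t r : ℝ) : mk w s t r 0 = w := rfl

theorem mk_one (w s t r : ℝ) : mk w s t r 1 = s := rfl

theorem mk_two (w s t r : ℝ) : mk w s t r 2 = t := rfl

theorem mk_three (w s t r : ℝ) : mk w s t r 3 = r := rfl

instance : Bracket WignerHeisenberg WignerHeisenberg :=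
  ⟨fun u v => mk 0 (u 0 * v 2 - u 2 * v 0) (-(u 0 * v 1 - u 1 * v 0)) (u 1 * v 2 - u 2 * v 1)⟩

theorem lie_eq (u v : WignerHeisenberg) : ⁅u, v⁆ =
    mk 0 (u 0 * v 2 - u 2 * v 0) (-(u 0 * v 1 - u 1 * v 0)) (u 1 * v 2 - u 2 * v 1) := rfl

instance : LieRing WignerHeisenberg where
  add_lie u v w := by
    apply ext_coords <;> simp only [lie_eq, add_apply, mk_zero, mk_one, mk_two, mk_three] <;> ring
  lie_add u v w := by
    apply ext_coords <;> simp only [lie_eq, add_apply, mk_zero, mk_one, mk_two, mk_three] <;> ring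
  lie_self u := by
    have h : (0 : WignerHeisenberg) = mk 0 0 0 0 := by
      apply ext_coords <;> rfl
    rw [h]
    apply ext_coords <;> simp only [lie_eq, mk_zero, mk_one, mk_two, mk_three] <;> ring
  leibniz_lie u v w := by
    apply ext_coords <;> simp only [lie_eq, add_apply, mk_zero, mk_one, mk_two, mk_three] <;> ring

instance : LieAlgebra ℝ WignerHeisenberg where
  lie_smul r u v := by
    apply ext_coords <;> simp only [lie_eq, smul_apply, mk_zero, mk_one, mk_two, mk_three] <;> ring

end WignerHeisenberg

end SingleMode

end

noncomputable section

namespace SingleMode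

open WeylAlgebra Polynomial

/-! ### Polynomial shifts -/

/-! Write N = a†a and let G be the complex span of g inside A₁. It is a finite-dimensional complex
Lie algebra, stable under the dagger, and g is exactly its skew-hermitian part. Since c is central,
bracketing with i(N + c) shows that G is stable under ad N. As A₁ is the sum of the ad N-eigenspaces
a†ᵏ f(N) and f(N) aᵏ, G is the sum of its homogeneous parts (`eq_iSup_inf_weight`).

The decisive point is `degree_bound`. Suppose a†ᵏ f(N) lies in G with k > 0 and f ≠ 0. A polynomial
h(N) in G acts on the weight-k part by multiplying f by h(X + k) - h(X); finite dimension forces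
this factor to be constant, so deg h ≤ 1. The bracket of a†ᵏ f(N) with its adjoint is such an h(N),
namely the k-shift difference of a polynomial of degree 2 deg f + k. Hence 2 deg f + k ≤ 2, so f is
constant and k is 1 or 2.

If no positive weight occurred, G would consist of polynomials in N and be commutative. So G
contains a† or a†², its weight-zero part lies in the span of 1 and N, and G lies in the span of 1,
N, a, a†, a², a†². Which of a†, a†², 1 belong to G determines G, and taking skew-hermitian parts
identifies g with one of four explicit quadratic realizations. -/

/-- A periodic polynomial takes the value h(0) at the infinitely many points nk. -/
theorem natDegree_eq_zero_of_shift_eq {k : ℂ} (hk : k ≠ 0) {h : ℂ[X]}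
    (hh : h.comp (X + C k) = h) : h.natDegree = 0 := by
  have hroot : ∀ n : ℕ, h.eval ((n : ℂ) * k) = h.eval 0 := by
    intro n
    induction n with
    | zero => simp
    | succ n ih =>
      rw [← ih]
      conv_rhs => rw [← hh]
      rw [eval_comp]
      congr 1
      simp
      ring
  have hz : h - C (h.eval 0) = 0 := by
    apply eq_zero_of_infinite_isRoot
    apply Set.Infinite.mono (s := Set.range fun n : ℕ => (n : ℂ) * k)
    · rintro _ ⟨n, rfl⟩
      simp [hroot n]
    · apply Set.infinite_range_of_injective
      intro m n hmn
      exact_mod_cast mul_right_cancel₀ hk hmn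
  rw [sub_eq_zero.mp hz]
  exact natDegree_C _

/-- Differentiation commutes with the shift difference and lowers degrees by one, so induction on m
reduces to a constant difference, where the derivative of h is periodic. -/
theorem natDegree_le_succ_of_shift_sub {k : ℂ} (hk : k ≠ 0) (m : ℕ) (h : ℂ[X])
    (hm : (h.comp (X + C k) - h).natDegree ≤ m) : h.natDegree ≤ m + 1 := by
  have hd : ∀ p : ℂ[X],
      derivative (p.comp (X + C k) - p) = (derivative p).comp (X + C k) - derivative p := by
    intro p
    simp [derivative_comp]
  induction m generalizing h with
  | zero =>
    have h0 : derivative (h.comp (X + C k) - h) = 0 :=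
      derivative_of_natDegree_zero (Nat.le_zero.mp hm)
    rw [hd, sub_eq_zero] at h0
    have := natDegree_eq_zero_of_shift_eq hk h0
    rw [natDegree_derivative] at this
    omega
  | succ m ih =>
    have := ih (derivative h) (by rw [← hd, natDegree_derivative]; omega)
    rw [natDegree_derivative] at this
    omega

/-! ### Components of a vector in an invariant subspace -/

theorem eigencomponent_mem {V ι : Type*} [AddCommGroup V] [Module ℂ V] [DecidableEq ι]
    (D : V →ₗ[ℂ] V) (p : Submodule ℂ V) (hp : ∀ x ∈ p, D x ∈ p) (μ : ι → ℂ)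
    (hμ : Function.Injective μ) (s : Finset ι) (v : ι → V) (hv : ∀ i, D (v i) = μ i • v i)
    (hs : ∑ i ∈ s, v i ∈ p) : ∀ i ∈ s, v i ∈ p := by
  induction s using Finset.induction_on generalizing v with
  | empty => simp
  | insert j s hj ih =>
    -- Applying D - μ j kills the j-th component and rescales the others by nonzero factors.
    have h1 : ∑ i ∈ s, (μ i - μ j) • v i ∈ p := by
      have h2 := p.sub_mem (hp _ hs) (p.smul_mem (μ j) hs)
      rw [Finset.sum_insert hj, map_add, map_sum, smul_add, Finset.smul_sum, hv,
        add_sub_add_left_eq_sub, ← Finset.sum_sub_distrib] at h2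
      simpa only [hv, sub_smul] using h2
    have h3 : ∀ i ∈ s, v i ∈ p := by
      intro i hi
      have h4 := ih (fun i => (μ i - μ j) • v i)
        (fun i => by rw [map_smul, hv, smul_comm]) h1 i hi
      have h5 : μ i - μ j ≠ 0 := sub_ne_zero.mpr fun h => hj (hμ h ▸ hi)
      exact (p.smul_mem_iff h5).mp h4
    intro i hi
    rcases Finset.mem_insert.mp hi with rfl | hi
    · rw [Finset.sum_insert hj] at hs
      exact (p.add_mem_iff_left (p.sum_mem h3)).mp hs
    · exact h3 i hi

/-! ### The Weyl algebra and polynomials in the number operator -/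

namespace WeylAlgebra

/-- The number operator `a† a`. -/
def num : WeylAlgebra := cre * ann

/-- A polynomial in the number operator. -/
def pol (f : ℂ[X]) : WeylAlgebra := aeval num f

theorem pol_mul (f g : ℂ[X]) : pol (f * g) = pol f * pol g := map_mul _ f g

theorem pol_add (f g : ℂ[X]) : pol (f + g) = pol f + pol g := map_add _ f g

theorem pol_sub (f g : ℂ[X]) : pol (f - g) = pol f - pol g := map_sub _ f g

theorem pol_C (r : ℂ) : pol (C r) = algebraMap ℂ WeylAlgebra r := aeval_C _ r

theorem pol_one : pol 1 = 1 := map_one _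

theorem pol_zero : pol 0 = 0 := map_zero _

theorem pol_X : pol X = num := aeval_X _

theorem pol_comm (f g : ℂ[X]) : pol f * pol g = pol g * pol f := by
  rw [← pol_mul, mul_comm, pol_mul]

theorem ann_mul_pol (f : ℂ[X]) : ann * pol f = pol (f.comp (X + 1)) * ann := by
  induction f using Polynomial.induction_on' with
  | add p q hp hq => rw [pol_add, mul_add, hp, hq, add_comp, pol_add, add_mul]
  | monomial n r =>
    rw [← C_mul_X_pow_eq_monomial, mul_comp, C_comp, pol_mul, pol_mul, pol_C, ← mul_assoc,
      ← Algebra.commutes, mul_assoc, mul_assoc]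
    congr 1
    rw [X_pow_comp]
    induction n with
    | zero => simp [pol_one]
    | succ n ih =>
      have h : ann * num = pol (X + 1) * ann := by
        rw [pol_add, pol_X, pol_one, num, ← mul_assoc, ann_mul_cre]
      rw [pow_succ, pol_mul, ← mul_assoc, ih, mul_assoc, pol_X, h, pow_succ, pol_mul, mul_assoc]

theorem pol_mul_cre (f : ℂ[X]) : pol f * cre = cre * pol (f.comp (X + 1)) := by
  induction f using Polynomial.induction_on' with
  | add p q hp hq => rw [pol_add, add_mul, hp, hq, add_comp, pol_add, mul_add]
  | monomial n r =>
    rw [← C_mul_X_pow_eq_monomial, mul_comp, C_comp, pol_mul, pol_mul, pol_C, ← mul_assoc cre,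
      ← Algebra.commutes, mul_assoc, mul_assoc]
    congr 1
    rw [X_pow_comp]
    induction n with
    | zero => simp [pol_one]
    | succ n ih =>
      have h : num * cre = cre * pol (X + 1) := by
        rw [pol_add, pol_X, pol_one, num, mul_assoc, ann_mul_cre]
      rw [pow_succ', pol_mul, mul_assoc, ih, ← mul_assoc, pol_X, h, pow_succ', pol_mul, mul_assoc]

theorem comp_shift_succ (f : ℂ[X]) (k : ℕ) :
    (f.comp (X + 1)).comp (X + C (k : ℂ)) = f.comp (X + C ((k + 1 : ℕ) : ℂ)) := by
  rw [comp_assoc]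
  congr 1
  simp
  ring

theorem ann_pow_mul_pol (k : ℕ) (f : ℂ[X]) :
    ann ^ k * pol f = pol (f.comp (X + C (k : ℂ))) * ann ^ k := by
  induction k generalizing f with
  | zero => simp
  | succ k ih => rw [pow_succ, mul_assoc, ann_mul_pol, ← mul_assoc, ih, comp_shift_succ, mul_assoc]

theorem pol_mul_cre_pow (k : ℕ) (f : ℂ[X]) :
    pol f * cre ^ k = cre ^ k * pol (f.comp (X + C (k : ℂ))) := by
  induction k generalizing f with
  | zero => simp
  | succ k ih => rw [pow_succ', ← mul_assoc, pol_mul_cre, mul_assoc, ih, comp_shift_succ, mul_assoc]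

theorem cre_pow_mul_pol (k : ℕ) (f : ℂ[X]) :
    cre ^ k * pol f = pol (f.comp (X - C (k : ℂ))) * cre ^ k := by
  rw [pol_mul_cre_pow, comp_assoc]
  simp

/-- The product is the falling factorial N(N - 1)⋯(N - k + 1); its degree is the source of the
summand k in `degree_bound`. -/
theorem cre_pow_mul_ann_pow (k : ℕ) : cre ^ k * ann ^ k = pol (descPochhammer ℂ k) := by
  induction k with
  | zero => simp [pol_one]
  | succ k ih =>
    calc cre ^ (k + 1) * ann ^ (k + 1) = cre ^ k * pol X * ann ^ k := by
          rw [pow_succ, pow_succ', pol_X, num]; simp only [mul_assoc]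
      _ = _ := by
          rw [cre_pow_mul_pol, mul_assoc, ih, X_comp, ← pol_mul, descPochhammer_succ_right, mul_comm]
          simp

theorem ann_pow_mul_cre_pow (k : ℕ) :
    ann ^ k * cre ^ k = pol ((descPochhammer ℂ k).comp (X + C (k : ℂ))) := by
  induction k with
  | zero => simp [pol_one]
  | succ k ih =>
    calc ann ^ (k + 1) * cre ^ (k + 1) = ann ^ k * (pol (X + 1) * cre ^ k) := by
          rw [pow_succ, pow_succ', pol_add, pol_one, pol_X, num, ← ann_mul_cre]
          simp only [mul_assoc]
      _ = _ := by
          rw [pol_mul_cre_pow, ← mul_assoc, ih, ← pol_mul, descPochhammer_succ_left, mul_comp,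
            comp_assoc, mul_comm]
          congr 2
          · simp; ring
          · congr 1; simp; ring

theorem star_ann_pow (k : ℕ) : star (ann ^ k) = cre ^ k := by rw [star_pow, star_ann]

theorem star_cre_pow (k : ℕ) : star (cre ^ k) = ann ^ k := by rw [star_pow, star_cre]

theorem star_num : star num = num := by rw [num, star_mul, star_ann, star_cre]

theorem star_pol (f : ℂ[X]) : star (pol f) = pol (f.map (starRingEnd ℂ)) := by
  induction f using Polynomial.induction_on' with
  | add p q hp hq => rw [pol_add, star_add, hp, hq, Polynomial.map_add, pol_add]
  | monomial n r =>
    rw [← C_mul_X_pow_eq_monomial, Polynomial.map_mul, Polynomial.map_pow, map_X, map_C, pol_mul,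
      pol_mul, star_mul, pol_C, pol_C, star_algebraMap, ← Algebra.commutes]
    congr 1
    rw [pol, map_pow, aeval_X, star_pow, star_num]

/-- The commutator of `a†ᵏ f(N)` with its adjoint. -/
theorem lie_star_self (k : ℕ) (f : ℂ[X]) :
    ⁅star (cre ^ k * pol f), cre ^ k * pol f⁆ =
      pol (((f * f.map (starRingEnd ℂ)).comp (X - C (k : ℂ)) * descPochhammer ℂ k).comp
        (X + C (k : ℂ)) - (f * f.map (starRingEnd ℂ)).comp (X - C (k : ℂ)) * descPochhammer ℂ k) := by
  rw [Ring.lie_def, star_mul, star_cre_pow, star_pol, pol_sub]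
  congr 1
  · calc _ = pol (f.map (starRingEnd ℂ)) * (ann ^ k * cre ^ k) * pol f := by
          simp only [mul_assoc]
      _ = _ := by
          rw [ann_pow_mul_cre_pow, mul_comp, comp_assoc, ← pol_mul, ← pol_mul]
          congr 1
          simp
          ring
  · calc _ = cre ^ k * pol (f * f.map (starRingEnd ℂ)) * ann ^ k := by
          simp only [mul_assoc, pol_mul]
      _ = _ := by
          rw [cre_pow_mul_pol, mul_assoc, cre_pow_mul_ann_pow, pol_mul]

/-! ### The Bargmann representation -/

/-- The representation on complex polynomials with `a = d/dX` and `a† = X`. -/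
def rep : WeylAlgebra →ₐ[ℂ] Module.End ℂ ℂ[X] :=
  RingQuot.liftAlgHom ℂ (s := CCR)
    ⟨FreeAlgebra.lift ℂ fun b => bif b then LinearMap.mulLeft ℂ (X : ℂ[X]) else derivative, by
      rintro _ _ ⟨⟩
      rw [map_mul, map_add, map_mul, map_one, FreeAlgebra.lift_ι_apply, FreeAlgebra.lift_ι_apply]
      refine LinearMap.ext fun p => ?_
      simp [Module.End.mul_apply, derivative_mul, add_comm]⟩

theorem rep_gen (b : Bool) :
    rep (gen b) = bif b then LinearMap.mulLeft ℂ (X : ℂ[X]) else derivative :=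
  (RingQuot.liftAlgHom_mkAlgHom_apply (S := ℂ) (s := CCR) _ _ _).trans
    (FreeAlgebra.lift_ι_apply _ _)

theorem rep_ann (p : ℂ[X]) : rep ann p = derivative p := by rw [ann, rep_gen]; rfl

theorem rep_cre (p : ℂ[X]) : rep cre p = X * p := by rw [cre, rep_gen]; rfl

theorem rep_cre_pow (k : ℕ) (p : ℂ[X]) : rep (cre ^ k) p = X ^ k * p := by
  induction k with
  | zero => simp
  | succ k ih =>
    rw [pow_succ', map_mul, Module.End.mul_apply, ih, rep_cre, ← mul_assoc, ← pow_succ']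

theorem rep_pol_X_pow (f : ℂ[X]) (n : ℕ) : rep (pol f) (X ^ n) = f.eval (n : ℂ) • X ^ n := by
  have h : rep num (X ^ n) = (n : ℂ) • X ^ n := by
    rw [num, map_mul, Module.End.mul_apply, rep_ann, rep_cre, derivative_X_pow, smul_eq_C_mul]
    cases n with
    | zero => simp
    | succ n => rw [Nat.add_sub_cancel]; ring
  rw [pol, ← aeval_algHom_apply]
  induction f using Polynomial.induction_on' with
  | add p q hp hq => rw [map_add, LinearMap.add_apply, hp, hq, eval_add, add_smul]
  | monomial m r =>
    rw [aeval_monomial, eval_monomial, Module.End.mul_apply, Module.algebraMap_end_apply, mul_smul]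
    congr 1
    induction m with
    | zero => simp
    | succ m ih => rw [pow_succ, Module.End.mul_apply, h, map_smul, ih, smul_smul, pow_succ, mul_comm]

/-- In the Bargmann representation the element sends Xⁿ to f(n) Xⁿ⁺ᵏ, so f vanishes at every natural
number. -/
theorem cre_pow_mul_pol_eq_zero {k : ℕ} {f : ℂ[X]} (h : cre ^ k * pol f = 0) : f = 0 := by
  apply eq_zero_of_infinite_isRoot
  apply Set.Infinite.mono (s := Set.range fun n : ℕ => (n : ℂ))
  · rintro _ ⟨n, rfl⟩
    have h1 : rep (cre ^ k) (rep (pol f) (X ^ n)) = 0 := by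
      rw [← Module.End.mul_apply, ← map_mul, h, map_zero, LinearMap.zero_apply]
    rw [rep_cre_pow, rep_pol_X_pow, mul_smul_comm, ← pow_add, smul_eq_zero] at h1
    exact h1.resolve_right (pow_ne_zero _ X_ne_zero)
  · exact Set.infinite_range_of_injective Nat.cast_injective

/-! ### The weight decomposition -/

/-- The elements of weight `k` under the number operator. -/
def weight : ℤ → Submodule ℂ WeylAlgebra
  | Int.ofNat k => LinearMap.range (LinearMap.mulLeft ℂ (cre ^ k) ∘ₗ (aeval num).toLinearMap)
  | Int.negSucc k =>
    LinearMap.range (LinearMap.mulRight ℂ (ann ^ (k + 1)) ∘ₗ (aeval num).toLinearMap)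

theorem mem_weight_natCast {k : ℕ} {x : WeylAlgebra} :
    x ∈ weight k ↔ ∃ f, cre ^ k * pol f = x := Iff.rfl

theorem mem_weight_negSucc {k : ℕ} {x : WeylAlgebra} :
    x ∈ weight (Int.negSucc k) ↔ ∃ f, pol f * ann ^ (k + 1) = x := Iff.rfl

theorem star_mem_weight {k : ℤ} {x : WeylAlgebra} (hx : x ∈ weight k) : star x ∈ weight (-k) := by
  match k with
  | Int.ofNat 0 =>
    obtain ⟨f, rfl⟩ := mem_weight_natCast.mp hx
    exact mem_weight_natCast.mpr ⟨f.map (starRingEnd ℂ), by rw [pow_zero, one_mul, one_mul, star_pol]⟩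
  | Int.ofNat (k + 1) =>
    obtain ⟨f, rfl⟩ := mem_weight_natCast.mp hx
    exact mem_weight_negSucc.mpr
      ⟨f.map (starRingEnd ℂ), by rw [star_mul, star_cre_pow, star_pol]⟩
  | Int.negSucc k =>
    obtain ⟨f, rfl⟩ := mem_weight_negSucc.mp hx
    exact mem_weight_natCast.mpr
      ⟨f.map (starRingEnd ℂ), by rw [star_mul, star_ann_pow, star_pol]⟩

theorem lie_num_of_mem_weight {k : ℤ} {x : WeylAlgebra} (hx : x ∈ weight k) :
    ⁅num, x⁆ = (k : ℂ) • x := by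
  match k with
  | Int.ofNat k =>
    obtain ⟨f, rfl⟩ := mem_weight_natCast.mp hx
    rw [Ring.lie_def, ← mul_assoc, ← pol_X, pol_mul_cre_pow, X_comp, mul_assoc, mul_assoc,
      pol_comm f, ← mul_sub, ← sub_mul, pol_add, add_sub_cancel_left, pol_C, ← Algebra.smul_def,
      mul_smul_comm]
    simp
  | Int.negSucc k =>
    obtain ⟨f, rfl⟩ := mem_weight_negSucc.mp hx
    rw [Ring.lie_def, mul_assoc, ← pol_X, ann_pow_mul_pol, X_comp, ← mul_assoc, ← mul_assoc,
      pol_comm X, ← sub_mul, ← mul_sub, pol_add, sub_add_cancel_left, pol_C, Algebra.smul_def,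
      Int.cast_negSucc, map_neg, neg_mul, mul_neg, neg_mul, ← Algebra.commutes, mul_assoc]

/-- The sum of the weight spaces contains 1 and is stable under left multiplication by the
generators, hence is a left ideal equal to the whole algebra. -/
theorem iSup_weight : ⨆ k, weight k = ⊤ := by
  have hle : ∀ (k : ℤ) (x : WeylAlgebra), x ∈ weight k → x ∈ ⨆ k, weight k :=
    fun k x hx => Submodule.mem_iSup_of_mem k hx
  have hmap : ∀ x : WeylAlgebra, (∀ k : ℤ, ∀ y ∈ weight k, x * y ∈ ⨆ k, weight k) →
      ∀ y ∈ ⨆ k, weight k, x * y ∈ ⨆ k, weight k := by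
    intro x hx
    have : ⨆ k, weight k ≤ (⨆ k, weight k).comap (LinearMap.mulLeft ℂ x) :=
      iSup_le fun k y hy => hx k y hy
    exact fun y hy => this hy
  have hmul : ∀ x : WeylAlgebra, ∀ y ∈ ⨆ k, weight k, x * y ∈ ⨆ k, weight k := by
    intro x
    induction x using WeylAlgebra.induction with
    | hs r =>
      intro y hy
      rw [← Algebra.smul_def]
      exact Submodule.smul_mem _ _ hy
    | hm x y hx hy =>
      intro z hz
      rw [mul_assoc]
      exact hx _ (hy _ hz)
    | ha x y hx hy =>
      intro z hz
      rw [add_mul]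
      exact Submodule.add_mem _ (hx _ hz) (hy _ hz)
    | hg b =>
      apply hmap
      intro k y hy
      match b, k with
      | true, Int.ofNat k =>
        obtain ⟨f, rfl⟩ := mem_weight_natCast.mp hy
        refine hle _ _ (mem_weight_natCast (k := k + 1).mpr ⟨f, ?_⟩)
        rw [pow_succ', mul_assoc, cre]
      | true, Int.negSucc k =>
        obtain ⟨f, rfl⟩ := mem_weight_negSucc.mp hy
        -- Here a† f(N) aᵏ⁺¹ = f(N - 1) N aᵏ; for k = 0 this has weight zero and falls under the
        -- nonnegative form.
        have h : gen true * (pol f * ann ^ (k + 1)) =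
            pol (f.comp (X - C ((1 : ℕ) : ℂ)) * X) * ann ^ k := by
          rw [← mul_assoc, ← cre, ← pow_one cre, cre_pow_mul_pol, pow_one, pow_succ', mul_assoc,
            pol_mul, pol_X, num]
          simp only [mul_assoc]
        rw [h]
        cases k with
        | zero =>
          exact hle _ _ (mem_weight_natCast (k := 0).mpr
            ⟨_, by rw [pow_zero, pow_zero, one_mul, mul_one]⟩)
        | succ k => exact hle _ _ (mem_weight_negSucc (k := k).mpr ⟨_, rfl⟩)
      | false, Int.ofNat 0 =>
        obtain ⟨f, rfl⟩ := mem_weight_natCast.mp hy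
        refine hle _ _ (mem_weight_negSucc (k := 0).mpr ⟨f.comp (X + 1), ?_⟩)
        rw [pow_zero, one_mul, zero_add, pow_one, ← ann_mul_pol, ann]
      | false, Int.ofNat (k + 1) =>
        obtain ⟨f, rfl⟩ := mem_weight_natCast.mp hy
        refine hle _ _ (mem_weight_natCast (k := k).mpr ⟨(X + 1).comp (X + C (k : ℂ)) * f, ?_⟩)
        rw [pol_mul, ← mul_assoc, ← pol_mul_cre_pow, pol_add, pol_X, pol_one, num, ← ann_mul_cre,
          pow_succ', ann]
        simp only [mul_assoc]
      | false, Int.negSucc k =>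
        obtain ⟨f, rfl⟩ := mem_weight_negSucc.mp hy
        refine hle _ _ (mem_weight_negSucc (k := k + 1).mpr ⟨f.comp (X + 1), ?_⟩)
        rw [pow_succ' _ (k + 1), ← mul_assoc, ← ann_mul_pol, ann, mul_assoc]
  refine eq_top_iff.mpr fun x _ => ?_
  rw [← mul_one x]
  exact hmul x 1 (hle 0 1 (mem_weight_natCast (k := 0).mpr
    ⟨1, by rw [pow_zero, one_mul, pol_one]⟩))

/-- A subspace stable under the commutator with `a† a` is spanned by its homogeneous elements. -/
theorem eq_iSup_inf_weight {G : Submodule ℂ WeylAlgebra} (hG : ∀ x ∈ G, ⁅num, x⁆ ∈ G) :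
    G = ⨆ k, G ⊓ weight k := by
  refine le_antisymm (fun x hx => ?_) (iSup_le fun _ => inf_le_left)
  have hx' : x ∈ ⨆ k, weight k := iSup_weight ▸ Submodule.mem_top
  obtain ⟨v, hv, rfl⟩ := (Submodule.mem_iSup_iff_exists_finsupp _ _).mp hx'
  -- The operator is ad N, whose eigenvalues on different weight spaces are distinct.
  have h := eigencomponent_mem (LinearMap.mulLeft ℂ num - LinearMap.mulRight ℂ num) G
    (fun x hx => hG x hx) (fun k : ℤ => (k : ℂ)) Int.cast_injective v.support v
    (fun k => lie_num_of_mem_weight (hv k)) hx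
  exact Submodule.sum_mem _ fun k hk => Submodule.mem_iSup_of_mem k ⟨h k hk, hv k⟩

/-! ### Degree bounds in finite-dimensional subspaces -/

/-- If r were not constant, the products rⁿ f would have unbounded degree, whereas a finite spanning
set bounds the degrees in S. -/
theorem natDegree_eq_zero_of_mul_mem {S : Submodule ℂ ℂ[X]} [FiniteDimensional ℂ S] {f r : ℂ[X]}
    (hf : f ∈ S) (hf0 : f ≠ 0) (hr : ∀ g ∈ S, r * g ∈ S) : r.natDegree = 0 := by
  by_contra h0
  have hr0 : r ≠ 0 := fun h => h0 (by rw [h, natDegree_zero])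
  have hmem : ∀ n : ℕ, r ^ n * f ∈ S := by
    intro n
    induction n with
    | zero => simpa using hf
    | succ n ih => rw [pow_succ', mul_assoc]; exact hr _ ih
  obtain ⟨n, hn⟩ : ∃ n, S ≤ degreeLT ℂ n := by
    obtain ⟨t, ht⟩ := (Submodule.fg_iff_finiteDimensional S).mpr inferInstance
    refine ⟨t.sup (fun p => p.natDegree + 1), ?_⟩
    rw [← ht, Submodule.span_le]
    intro p hp
    rw [SetLike.mem_coe, mem_degreeLT]
    refine degree_le_natDegree.trans_lt ?_
    have := Finset.le_sup (f := fun p : ℂ[X] => p.natDegree + 1) hp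
    exact_mod_cast this
  have h1 := mem_degreeLT.mp (hn (hmem n))
  rw [degree_eq_natDegree (mul_ne_zero (pow_ne_zero _ hr0) hf0), Nat.cast_lt,
    natDegree_mul (pow_ne_zero _ hr0) hf0, natDegree_pow] at h1
  nlinarith [Nat.pos_of_ne_zero h0]

/-- The bracket of h(N) with a†ᵏ g(N) is a†ᵏ (h(N + k) - h(N)) g(N). So the polynomials g with a†ᵏ
g(N) in G form a finite-dimensional space stable under multiplication by h(X + k) - h(X), which must
be constant. -/
theorem natDegree_le_one_of_pol_mem {G : Submodule ℂ WeylAlgebra} [FiniteDimensional ℂ G]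
    (hG : ∀ x ∈ G, ∀ y ∈ G, ⁅x, y⁆ ∈ G) {k : ℕ} (hk : k ≠ 0) {f h : ℂ[X]} (hf0 : f ≠ 0)
    (hf : cre ^ k * pol f ∈ G) (hh : pol h ∈ G) : h.natDegree ≤ 1 := by
  let T : ℂ[X] →ₗ[ℂ] WeylAlgebra := LinearMap.mulLeft ℂ (cre ^ k) ∘ₗ (aeval num).toLinearMap
  have hT : ∀ g, T g = cre ^ k * pol g := fun _ => rfl
  have hinj : Function.Injective T :=
    (injective_iff_map_eq_zero T).mpr fun g hg => cre_pow_mul_pol_eq_zero hg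
  have : FiniteDimensional ℂ (G.comap T) :=
    Module.Finite.of_injective (T.restrict (p := G.comap T) (q := G) fun _ h => h)
      fun a b hab => Subtype.ext (hinj (congrArg Subtype.val hab))
  refine natDegree_le_succ_of_shift_sub (k := (k : ℂ)) (Nat.cast_ne_zero.mpr hk) 0 h
    (natDegree_eq_zero_of_mul_mem (S := G.comap T) (f := f) hf hf0 fun g hg => ?_).le
  have h1 := hG _ hh _ hg
  rw [hT, Ring.lie_def, ← mul_assoc, pol_mul_cre_pow, mul_assoc, mul_assoc, pol_comm g, ← mul_sub,
    ← sub_mul, ← pol_sub, ← pol_mul] at h1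
  exact h1

theorem degree_bound {G : Submodule ℂ WeylAlgebra} [FiniteDimensional ℂ G]
    (hG : ∀ x ∈ G, ∀ y ∈ G, ⁅x, y⁆ ∈ G) (hs : ∀ x ∈ G, star x ∈ G) {k : ℕ} (hk : k ≠ 0)
    {f : ℂ[X]} (hf0 : f ≠ 0) (hf : cre ^ k * pol f ∈ G) : 2 * f.natDegree + k ≤ 2 := by
  have h1 := hG _ (hs _ hf) _ hf
  rw [lie_star_self] at h1
  -- `lie_star_self` writes the bracket as a shift difference; its degree is at most 1, so the
  -- polynomial being shifted has degree at most 2.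
  have h2 := natDegree_le_succ_of_shift_sub (k := (k : ℂ)) (Nat.cast_ne_zero.mpr hk) 1 _
    (natDegree_le_one_of_pol_mem hG hk hf0 hf h1)
  have hf1 : f.map (starRingEnd ℂ) ≠ 0 := by
    rwa [Ne, Polynomial.map_eq_zero]
  have h3 : (f * f.map (starRingEnd ℂ)).comp (X - C (k : ℂ)) ≠ 0 := by
    intro h
    have h4 := congrArg (fun p => p.comp (X + C (k : ℂ))) h
    simp [comp_assoc, hf0] at h4
  rw [natDegree_mul h3 (monic_descPochhammer ℂ k).ne_zero, natDegree_comp, natDegree_X_sub_C,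
    natDegree_mul hf0 hf1, natDegree_map, descPochhammer_natDegree] at h2
  omega

end WeylAlgebra

namespace WeylAlgebra

/-! ### Quadratic elements -/

/-- The quadratic element with the given coefficients at `1, a†a, a, a†, a², a†²`. -/
def quad (α β γ δ ε ζ : ℂ) : WeylAlgebra :=
  α • (1 : WeylAlgebra) + β • num + γ • ann + δ • cre + ε • ann ^ 2 + ζ • cre ^ 2

theorem quad_add (α β γ δ ε ζ α' β' γ' δ' ε' ζ' : ℂ) :
    quad α β γ δ ε ζ + quad α' β' γ' δ' ε' ζ' =
      quad (α + α') (β + β') (γ + γ') (δ + δ') (ε + ε') (ζ + ζ') := by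
  simp only [quad]
  module

theorem quad_smul (r : ℝ) (α β γ δ ε ζ : ℂ) :
    r • quad α β γ δ ε ζ = quad (r * α) (r * β) (r * γ) (r * δ) (r * ε) (r * ζ) := by
  rw [← Complex.coe_smul]
  simp only [quad]
  module

theorem star_quad (α β γ δ ε ζ : ℂ) :
    star (quad α β γ δ ε ζ) = quad (star α) (star β) (star δ) (star γ) (star ζ) (star ε) := by
  simp only [quad, star_add, star_smul, star_one, star_num, star_ann, star_cre, star_ann_pow,
    star_cre_pow]
  abel

theorem neg_quad (α β γ δ ε ζ : ℂ) :
    -quad α β γ δ ε ζ = quad (-α) (-β) (-γ) (-δ) (-ε) (-ζ) := by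
  simp only [quad]
  module

/-- The commutation relation with a trailing factor lets `simp` normal-order right-associated
products. -/
theorem ann_mul_cre_mul (x : WeylAlgebra) : ann * (cre * x) = cre * (ann * x) + x := by
  rw [← mul_assoc, ann_mul_cre, add_mul, one_mul, mul_assoc]

theorem lie_quad (α β γ δ ε ζ α' β' γ' δ' ε' ζ' : ℂ) :
    ⁅quad α β γ δ ε ζ, quad α' β' γ' δ' ε' ζ'⁆ =
      quad (γ * δ' - δ * γ' + 2 * (ε * ζ' - ζ * ε')) (4 * (ε * ζ' - ζ * ε'))
        (γ * β' - β * γ' + 2 * (ε * δ' - δ * ε')) (β * δ' - δ * β' + 2 * (γ * ζ' - ζ * γ'))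
        (2 * (ε * β' - β * ε')) (2 * (β * ζ' - ζ * β')) := by
  simp only [quad, num, pow_two, Ring.lie_def, mul_add, add_mul, mul_assoc, ann_mul_cre_mul,
    ann_mul_cre, smul_mul_assoc, mul_smul_comm, one_mul, mul_one, smul_add, smul_smul]
  module

/-- The coefficients are read off from the action on 1 (giving α, δ, ζ), on X (giving γ, α + β) and
on X² (giving 2ε). -/
theorem quad_eq_zero {α β γ δ ε ζ : ℂ} (h : quad α β γ δ ε ζ = 0) :
    α = 0 ∧ β = 0 ∧ γ = 0 ∧ δ = 0 ∧ ε = 0 ∧ ζ = 0 := by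
  have key : ∀ p : ℂ[X], C α * p + C β * (X * derivative p) + C γ * derivative p + C δ * (X * p) +
      C ε * derivative (derivative p) + C ζ * (X * (X * p)) = 0 := by
    intro p
    have h1 : rep (quad α β γ δ ε ζ) p = 0 := by rw [h, map_zero, LinearMap.zero_apply]
    simpa only [quad, num, pow_two, map_add, map_mul, map_smul, map_one, LinearMap.add_apply,
      LinearMap.smul_apply, Module.End.mul_apply, Module.End.one_apply, rep_ann, rep_cre,
      smul_eq_C_mul] using h1
  have k1 := key 1
  have k2 := key X
  have k3 := key (X ^ 2)
  have c0 := congrArg (coeff · 0) k1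
  have c1 := congrArg (coeff · 1) k1
  have c2 := congrArg (coeff · 2) k1
  have d0 := congrArg (coeff · 0) k2
  have d1 := congrArg (coeff · 1) k2
  have e0 := congrArg (coeff · 0) k3
  simp [coeff_X, coeff_one, coeff_C, pow_two] at c0 c1 c2 d0 d1 e0
  simp_all

/-! ### Homogeneous elements of a finite-dimensional subalgebra -/

theorem pol_eq_of_natDegree_le_one {h : ℂ[X]} (hh : h.natDegree ≤ 1) :
    pol h = h.coeff 0 • (1 : WeylAlgebra) + h.coeff 1 • num := by
  conv_lhs => rw [eq_X_add_C_of_natDegree_le_one hh]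
  rw [pol_add, pol_mul, pol_C, pol_C, pol_X, ← Algebra.smul_def, Algebra.algebraMap_eq_smul_one,
    add_comm]

theorem mem_weight_of_pos {G : Submodule ℂ WeylAlgebra} [FiniteDimensional ℂ G]
    (hG : ∀ x ∈ G, ∀ y ∈ G, ⁅x, y⁆ ∈ G) (hs : ∀ x ∈ G, star x ∈ G) {k : ℕ} (hk : k ≠ 0)
    {x : WeylAlgebra} (hx : x ∈ G) (hxk : x ∈ weight k) (hx0 : x ≠ 0) :
    (k = 1 ∧ cre ∈ G ∧ ∃ r : ℂ, x = r • cre) ∨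
      (k = 2 ∧ cre ^ 2 ∈ G ∧ ∃ r : ℂ, x = r • cre ^ 2) := by
  obtain ⟨f, rfl⟩ := mem_weight_natCast.mp hxk
  have hf0 : f ≠ 0 := fun h => hx0 (by rw [h, pol_zero, mul_zero])
  have hd := degree_bound hG hs hk hf0 hx
  have hc : f = C (f.coeff 0) := eq_C_of_natDegree_eq_zero (by omega)
  have hr : f.coeff 0 ≠ 0 := fun h => hf0 (by rw [hc, h, C_0])
  have he : cre ^ k * pol f = f.coeff 0 • cre ^ k := by
    conv_lhs => rw [hc]
    rw [pol_C, ← Algebra.commutes, ← Algebra.smul_def]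
  rw [he] at hx ⊢
  rw [G.smul_mem_iff hr] at hx
  obtain rfl | rfl : k = 1 ∨ k = 2 := by omega
  · rw [pow_one] at hx ⊢
    exact Or.inl ⟨rfl, hx, _, rfl⟩
  · exact Or.inr ⟨rfl, hx, _, rfl⟩

/-- Negative weights are adjoints of positive ones, and by `mem_weight_of_pos` the positive part is
spanned by a† and a†² when these lie in G. So only three kinds of elements need testing. -/
theorem le_of_weights {G T : Submodule ℂ WeylAlgebra} [FiniteDimensional ℂ G]
    (hG : ∀ x ∈ G, ∀ y ∈ G, ⁅x, y⁆ ∈ G) (hs : ∀ x ∈ G, star x ∈ G)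
    (hN : ∀ x ∈ G, ⁅num, x⁆ ∈ G) (hT : ∀ x ∈ T, star x ∈ T) (h0 : ∀ h, pol h ∈ G → pol h ∈ T)
    (h1 : cre ∈ G → cre ∈ T) (h2 : cre ^ 2 ∈ G → cre ^ 2 ∈ T) : G ≤ T := by
  have hpos : ∀ k : ℕ, G ⊓ weight k ≤ T := by
    rintro k x ⟨hx, hxk⟩
    rcases eq_or_ne k 0 with rfl | hk
    · obtain ⟨f, rfl⟩ := mem_weight_natCast.mp hxk
      rw [pow_zero, one_mul] at hx ⊢
      exact h0 f hx
    · rcases eq_or_ne x 0 with rfl | hx0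
      · exact T.zero_mem
      · rcases mem_weight_of_pos hG hs hk hx hxk hx0 with ⟨-, hc, r, rfl⟩ | ⟨-, hc, r, rfl⟩
        · exact T.smul_mem r (h1 hc)
        · exact T.smul_mem r (h2 hc)
  rw [eq_iSup_inf_weight hN]
  refine iSup_le fun k => ?_
  match k with
  | Int.ofNat k => exact hpos k
  | Int.negSucc k =>
    rintro x ⟨hx, hxk⟩
    rw [← star_star x]
    exact hT _ (hpos (k + 1) ⟨hs x hx, star_mem_weight hxk⟩)

/-- A noncommutative subspace contains a homogeneous element of weight one or two. -/
theorem cre_mem_or_cre_sq_mem {G : Submodule ℂ WeylAlgebra} [FiniteDimensional ℂ G]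
    (hG : ∀ x ∈ G, ∀ y ∈ G, ⁅x, y⁆ ∈ G) (hs : ∀ x ∈ G, star x ∈ G)
    (hN : ∀ x ∈ G, ⁅num, x⁆ ∈ G) (hna : ∃ x ∈ G, ∃ y ∈ G, ⁅x, y⁆ ≠ 0) :
    cre ∈ G ∨ cre ^ 2 ∈ G := by
  by_contra! hcon
  -- Without positive weights, G would consist of polynomials in N, which commute.
  have hle : G ≤ LinearMap.range (aeval (R := ℂ) num).toLinearMap := by
    refine le_of_weights hG hs hN ?_ (fun h _ => ⟨h, rfl⟩) (fun h => absurd h hcon.1)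
      (fun h => absurd h hcon.2)
    rintro _ ⟨f, rfl⟩
    exact ⟨_, (star_pol f).symm⟩
  obtain ⟨x, hx, y, hy, hxy⟩ := hna
  obtain ⟨f, rfl⟩ := hle hx
  obtain ⟨h, rfl⟩ := hle hy
  exact hxy (sub_eq_zero.mpr (pol_comm f h))

/-- Either of a†, a†² serves as the element of positive weight, with f = 1, that bounds the degree
of h. -/
theorem exists_pol_eq {G : Submodule ℂ WeylAlgebra} [FiniteDimensional ℂ G]
    (hG : ∀ x ∈ G, ∀ y ∈ G, ⁅x, y⁆ ∈ G) (h12 : cre ∈ G ∨ cre ^ 2 ∈ G) {h : ℂ[X]}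
    (hh : pol h ∈ G) : ∃ α β : ℂ, pol h = α • (1 : WeylAlgebra) + β • num := by
  refine ⟨_, _, pol_eq_of_natDegree_le_one ?_⟩
  rcases h12 with h1 | h2
  · exact natDegree_le_one_of_pol_mem hG (k := 1) one_ne_zero (f := 1) one_ne_zero
      (by rwa [pol_one, mul_one, pow_one]) hh
  · exact natDegree_le_one_of_pol_mem hG (k := 2) two_ne_zero (f := 1) one_ne_zero
      (by rwa [pol_one, mul_one]) hh

/-- The complex subspace of all elements whose complex multiples have their skew-hermitian part in
a given real subspace. -/
def complexHull (R : Submodule ℝ WeylAlgebra) : Submodule ℂ WeylAlgebra where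
  carrier := {p | ∀ z : ℂ, z • p - star (z • p) ∈ R}
  add_mem' {p q} hp hq z := by
    have := R.add_mem (hp z) (hq z)
    rwa [sub_add_sub_comm, ← star_add, ← smul_add] at this
  zero_mem' z := by
    rw [smul_zero, star_zero, sub_zero]
    exact R.zero_mem
  smul_mem' w p hp z := by
    rw [smul_smul]
    exact hp _

/-- Replacing p by p† replaces z by its conjugate and changes a sign. This makes the hull an
admissible target T in `le_of_weights`. -/
theorem star_mem_complexHull {R : Submodule ℝ WeylAlgebra} {p : WeylAlgebra}
    (hp : p ∈ complexHull R) : star p ∈ complexHull R := by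
  intro z
  have := R.neg_mem (hp (star z))
  rwa [neg_sub, star_smul, star_star, ← star_star (star z • p), star_smul, star_star] at this

end WeylAlgebra

/-! ### Realizations by quadratic elements -/

theorem SL2.lie_apply (M N : SL2) (i j : Fin 2) :
    ⁅M, N⁆.val i j = M.val i 0 * N.val 0 j + M.val i 1 * N.val 1 j -
      (N.val i 0 * M.val 0 j + N.val i 1 * M.val 1 j) := by
  simp [Ring.lie_def, Matrix.mul_apply, Fin.sum_univ_two]

theorem SL2.ext_entries {M N : SL2} (h0 : M.val 0 0 = N.val 0 0) (h1 : M.val 0 1 = N.val 0 1)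
    (h2 : M.val 1 0 = N.val 1 0) : M = N := by
  have hM := M.trace_zero
  have hN := N.trace_zero
  apply Subtype.ext
  ext i j
  fin_cases i <;> fin_cases j
  exacts [h0, h1, h2, by change M.val 1 1 = N.val 1 1; linarith]

/-- The matrix with rows `(a, b)` and `(c, -a)`. -/
def SL2.mk (a b c : ℝ) : SL2 :=
  ⟨!![a, b; c, -a], by
    change Matrix.trace !![a, b; c, -a] = 0
    simp [Matrix.trace_fin_two]⟩

open Complex (I)

/-- The quadratic element attached to a traceless matrix with first row `(a, b)` and lower left
entry `c`, to the vector `(s, t)` and to the central coordinate `r`. -/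
def schrodingerElement (a b c s t r : ℝ) : WeylAlgebra :=
  -- In the usual bases, h ↦ (a² - a†²)/2, x ↦ -(i/4)(a + a†)², y ↦ -(i/4)(a - a†)², q ↦ i(a + a†),
  -- p ↦ a - a†, z ↦ -2i.
  quad (-(I / 4) * (b - c) - 2 * I * r) (-(I / 2) * (b - c)) (I * s + t) (I * s - t)
    (a / 2 - I / 4 * (b + c)) (-a / 2 - I / 4 * (b + c))

theorem schrodingerElement_add (a b c s t r a' b' c' s' t' r' : ℝ) :
    schrodingerElement (a + a') (b + b') (c + c') (s + s') (t + t') (r + r') =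
      schrodingerElement a b c s t r + schrodingerElement a' b' c' s' t' r' := by
  rw [schrodingerElement, schrodingerElement, schrodingerElement, quad_add]
  push_cast
  congr 1 <;> ring

theorem schrodingerElement_smul (w a b c s t r : ℝ) :
    schrodingerElement (w * a) (w * b) (w * c) (w * s) (w * t) (w * r) =
      w • schrodingerElement a b c s t r := by
  rw [schrodingerElement, schrodingerElement, quad_smul]
  push_cast
  congr 1 <;> ring

theorem lie_schrodingerElement (a b c s t r a' b' c' s' t' r' : ℝ) :
    ⁅schrodingerElement a b c s t r, schrodingerElement a' b' c' s' t' r'⁆ =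
      schrodingerElement (b * c' - c * b') (2 * (a * b' - b * a')) (2 * (c * a' - a * c'))
        (a * s' + b * t' - (a' * s + b' * t)) (c * s' - a * t' - (c' * s - a' * t))
        (s * t' - t * s') := by
  rw [schrodingerElement, schrodingerElement, schrodingerElement, lie_quad]
  push_cast
  congr 1 <;> ring_nf <;> simp only [Complex.I_sq] <;> ring

theorem star_schrodingerElement (a b c s t r : ℝ) :
    star (schrodingerElement a b c s t r) = -schrodingerElement a b c s t r := by
  rw [schrodingerElement, star_quad, neg_quad]
  congr 1 <;> apply Complex.ext <;> simp <;> ring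

theorem schrodingerElement_eq_zero {a b c s t r : ℝ} (h : schrodingerElement a b c s t r = 0) :
    a = 0 ∧ b = 0 ∧ c = 0 ∧ s = 0 ∧ t = 0 ∧ r = 0 := by
  obtain ⟨h1, h2, h3, h4, h5, h6⟩ := quad_eq_zero h
  have i1 := congrArg Complex.im h1
  have i2 := congrArg Complex.im h2
  have i3 := congrArg Complex.im h3
  have r3 := congrArg Complex.re h3
  have i5 := congrArg Complex.im h5
  have r5 := congrArg Complex.re h5
  simp at i1 i2 i3 r3 i5 r5
  refine ⟨?_, ?_, ?_, ?_, ?_, ?_⟩ <;> linarith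

/-- The Schrödinger algebra, realized by the skew-hermitian elements of degree at most two. -/
def schrodingerHom : Schrodinger →ₗ⁅ℝ⁆ WeylAlgebra where
  toFun w := schrodingerElement (w.right.val 0 0) (w.right.val 0 1) (w.right.val 1 0)
    (w.left 0) (w.left 1) (w.left 2)
  map_add' v w := schrodingerElement_add ..
  map_smul' r w := schrodingerElement_smul ..
  map_lie' {v w} := by
    have hv := v.right.trace_zero
    have hw := w.right.trace_zero
    have hv' : v.right.val 1 1 = -v.right.val 0 0 := by linarith
    have hw' : w.right.val 1 1 = -w.right.val 0 0 := by linarith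
    rw [lie_schrodingerElement]
    change schrodingerElement (⁅v.right, w.right⁆.val 0 0) (⁅v.right, w.right⁆.val 0 1)
      (⁅v.right, w.right⁆.val 1 0)
      (0 + (v.right.val 0 0 * w.left 0 + v.right.val 0 1 * w.left 1) -
        (w.right.val 0 0 * v.left 0 + w.right.val 0 1 * v.left 1))
      (0 + (v.right.val 1 0 * w.left 0 + v.right.val 1 1 * w.left 1) -
        (w.right.val 1 0 * v.left 0 + w.right.val 1 1 * v.left 1))
      ((v.left 0 * w.left 1 - v.left 1 * w.left 0) + 0 - 0) = _
    simp only [SL2.lie_apply, hv', hw']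
    congr 1 <;> ring

/-- The direct sum of `𝔰𝔩(2, ℝ)` and `ℝ`, realized by quadratic elements and scalars. -/
def sl2ProdHom : (SL2 × ℝ) →ₗ⁅ℝ⁆ WeylAlgebra where
  toFun w := schrodingerElement (w.1.val 0 0) (w.1.val 0 1) (w.1.val 1 0) 0 0 w.2
  map_add' v w := by
    rw [← schrodingerElement_add, add_zero]
    rfl
  map_smul' r w := by
    rw [RingHom.id_apply, ← schrodingerElement_smul, mul_zero]
    rfl
  map_lie' {v w} := by
    have hv := v.1.trace_zero
    have hw := w.1.trace_zero
    have hv' : v.1.val 1 1 = -v.1.val 0 0 := by linarith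
    have hw' : w.1.val 1 1 = -w.1.val 0 0 := by linarith
    have h2 : ⁅v.2, w.2⁆ = 0 := sub_eq_zero.mpr (mul_comm _ _)
    rw [lie_schrodingerElement]
    change schrodingerElement (⁅v.1, w.1⁆.val 0 0) (⁅v.1, w.1⁆.val 0 1) (⁅v.1, w.1⁆.val 1 0)
      0 0 ⁅v.2, w.2⁆ = _
    simp only [SL2.lie_apply, hv', hw', h2]
    congr 1 <;> ring

/-- The Lie algebra `𝔰𝔩(2, ℝ)`, realized by quadratic elements. -/
def sl2Hom : SL2 →ₗ⁅ℝ⁆ WeylAlgebra where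
  toFun w := schrodingerElement (w.val 0 0) (w.val 0 1) (w.val 1 0) 0 0 0
  map_add' v w := by
    rw [← schrodingerElement_add, add_zero]
    rfl
  map_smul' r w := by
    rw [RingHom.id_apply, ← schrodingerElement_smul, mul_zero]
    rfl
  map_lie' {v w} := by
    have hv := v.trace_zero
    have hw := w.trace_zero
    have hv' : v.val 1 1 = -v.val 0 0 := by linarith
    have hw' : w.val 1 1 = -w.val 0 0 := by linarith
    rw [lie_schrodingerElement]
    simp only [SL2.lie_apply, hv', hw']
    congr 1 <;> ring

/-- The Wigner-Heisenberg algebra, realized by `-i a†a` and the elements of degree at most one. -/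
def wignerHeisenbergHom : WignerHeisenberg →ₗ⁅ℝ⁆ WeylAlgebra where
  -- The central shift -u₀/4 cancels the scalar -i/2 that accompanies -iN in the image of x - y.
  toFun u := schrodingerElement 0 (u 0) (-u 0) (u 1) (u 2) (u 3 - u 0 / 4)
  map_add' u v := by
    rw [← schrodingerElement_add]
    simp only [WignerHeisenberg.add_apply]
    congr 1 <;> ring
  map_smul' r u := by
    rw [RingHom.id_apply, ← schrodingerElement_smul]
    simp only [WignerHeisenberg.smul_apply]
    congr 1 <;> ring
  map_lie' {u v} := by
    rw [lie_schrodingerElement]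
    simp only [WignerHeisenberg.lie_eq, WignerHeisenberg.mk_zero, WignerHeisenberg.mk_one,
      WignerHeisenberg.mk_two, WignerHeisenberg.mk_three]
    congr 1 <;> ring

theorem schrodingerHom_injective : Function.Injective schrodingerHom := by
  refine (injective_iff_map_eq_zero schrodingerHom).mpr fun w hw => ?_
  obtain ⟨h1, h2, h3, h4, h5, h6⟩ := schrodingerElement_eq_zero hw
  exact LieAlgebra.SemiDirectSum.ext (Heisenberg.ext_coords h4 h5 h6) (SL2.ext_entries h1 h2 h3)

theorem sl2ProdHom_injective : Function.Injective sl2ProdHom := by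
  refine (injective_iff_map_eq_zero sl2ProdHom).mpr fun w hw => ?_
  obtain ⟨h1, h2, h3, -, -, h6⟩ := schrodingerElement_eq_zero hw
  exact Prod.ext (SL2.ext_entries h1 h2 h3) h6

theorem sl2Hom_injective : Function.Injective sl2Hom := by
  refine (injective_iff_map_eq_zero sl2Hom).mpr fun w hw => ?_
  obtain ⟨h1, h2, h3, -, -, -⟩ := schrodingerElement_eq_zero hw
  exact SL2.ext_entries h1 h2 h3

theorem wignerHeisenbergHom_injective : Function.Injective wignerHeisenbergHom := by
  refine (injective_iff_map_eq_zero wignerHeisenbergHom).mpr fun u hu => ?_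
  obtain ⟨-, h2, -, h4, h5, h6⟩ := schrodingerElement_eq_zero hu
  exact WignerHeisenberg.ext_coords h2 h4 h5 (by rw [h2, zero_div, sub_zero] at h6; exact h6)

/-! ### The Wigner-Heisenberg algebra is solvable -/

/-- The derived series lies in the span of q, p, z after one step, in the span of z after two, and
vanishes after three. -/
theorem WignerHeisenberg.isSolvable : LieAlgebra.IsSolvable WignerHeisenberg := by
  let I₁ : LieIdeal ℝ WignerHeisenberg :=
    { carrier := {u | u 0 = 0}
      add_mem' := fun {u v} hu hv => by
        change u 0 + v 0 = 0
        rw [show u 0 = 0 from hu, show v 0 = 0 from hv, add_zero]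
      zero_mem' := rfl
      smul_mem' := fun r u hu => by
        change r * u 0 = 0
        rw [show u 0 = 0 from hu, mul_zero]
      lie_mem := fun {_ _} _ => rfl }
  let I₂ : LieIdeal ℝ WignerHeisenberg :=
    { carrier := {u | u 0 = 0 ∧ u 1 = 0 ∧ u 2 = 0}
      add_mem' := fun {u v} hu hv => by
        refine ⟨?_, ?_, ?_⟩ <;> rw [WignerHeisenberg.add_apply]
        exacts [by rw [hu.1, hv.1, add_zero], by rw [hu.2.1, hv.2.1, add_zero],
          by rw [hu.2.2, hv.2.2, add_zero]]
      zero_mem' := ⟨rfl, rfl, rfl⟩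
      smul_mem' := fun r u hu => by
        refine ⟨?_, ?_, ?_⟩ <;> rw [WignerHeisenberg.smul_apply]
        exacts [by rw [hu.1, mul_zero], by rw [hu.2.1, mul_zero], by rw [hu.2.2, mul_zero]]
      lie_mem := fun {v u} hu => by
        obtain ⟨h0, h1, h2⟩ := hu
        refine ⟨rfl, ?_, ?_⟩
        · change v 0 * u 2 - v 2 * u 0 = 0
          rw [h0, h2, mul_zero, mul_zero, sub_zero]
        · change -(v 0 * u 1 - v 1 * u 0) = 0
          rw [h0, h1, mul_zero, mul_zero, sub_zero, neg_zero] }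
  have h1 : LieAlgebra.derivedSeries ℝ WignerHeisenberg 1 ≤ I₁ := by
    rw [LieAlgebra.derivedSeries_def, LieAlgebra.derivedSeriesOfIdeal_succ,
      LieSubmodule.lieIdeal_oper_eq_span, LieSubmodule.lieSpan_le]
    rintro _ ⟨u, v, rfl⟩
    rfl
  have h2 : LieAlgebra.derivedSeries ℝ WignerHeisenberg 2 ≤ I₂ := by
    rw [LieAlgebra.derivedSeries_def, LieAlgebra.derivedSeriesOfIdeal_succ]
    refine (LieSubmodule.mono_lie h1 h1).trans ?_
    rw [LieSubmodule.lieIdeal_oper_eq_span, LieSubmodule.lieSpan_le]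
    rintro _ ⟨⟨u, hu⟩, ⟨v, hv⟩, rfl⟩
    have hu' : u 0 = 0 := hu
    have hv' : v 0 = 0 := hv
    refine ⟨rfl, ?_, ?_⟩
    · change u 0 * v 2 - u 2 * v 0 = 0
      rw [hu', hv', zero_mul, mul_zero, sub_zero]
    · change -(u 0 * v 1 - u 1 * v 0) = 0
      rw [hu', hv', zero_mul, mul_zero, sub_zero, neg_zero]
  refine LieAlgebra.IsSolvable.mk (R := ℝ) (k := 3) ?_
  rw [LieAlgebra.derivedSeries_def, LieAlgebra.derivedSeriesOfIdeal_succ, eq_bot_iff]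
  refine (LieSubmodule.mono_lie h2 h2).trans ?_
  rw [LieSubmodule.lieIdeal_oper_eq_span, LieSubmodule.lieSpan_le]
  rintro _ ⟨⟨u, hu0, hu1, hu2⟩, ⟨v, hv0, hv1, hv2⟩, rfl⟩
  refine WignerHeisenberg.ext_coords rfl ?_ ?_ ?_
  · change u 0 * v 2 - u 2 * v 0 = 0
    rw [hu0, hu2, zero_mul, zero_mul, sub_zero]
  · change -(u 0 * v 1 - u 1 * v 0) = 0
    rw [hu0, hu1, zero_mul, zero_mul, sub_zero, neg_zero]
  · change u 1 * v 2 - u 2 * v 1 = 0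
    rw [hu1, hu2, zero_mul, zero_mul, sub_zero]

/-! ### The complex span of a subalgebra of skew-hermitian elements -/

section ComplexSpan

variable (g : LieSubalgebra ℝ skewWeyl)

/-- The inclusion of a subalgebra of the skew-hermitian Weyl algebra into the Weyl algebra. -/
def inclusion : g →ₗ⁅ℝ⁆ WeylAlgebra := skewWeyl.incl.comp g.incl

theorem inclusion_injective : Function.Injective (inclusion g) := fun _ _ h =>
  Subtype.ext (Subtype.ext h)

theorem star_inclusion (x : g) : star (inclusion g x) = -inclusion g x := x.val.property

/-- The complex subspace of the Weyl algebra spanned by a subalgebra of skew-hermitian elements. -/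
def complexSpan : Submodule ℂ WeylAlgebra := Submodule.span ℂ (Set.range (inclusion g))

theorem inclusion_mem_complexSpan (x : g) : inclusion g x ∈ complexSpan g :=
  Submodule.subset_span ⟨x, rfl⟩

/-- The sums p + iq are already closed under complex scalars. -/
theorem mem_complexSpan {x : WeylAlgebra} (hx : x ∈ complexSpan g) :
    ∃ p q : g, x = inclusion g p + I • inclusion g q := by
  induction hx using Submodule.span_induction with
  | mem x hx =>
    obtain ⟨p, rfl⟩ := hx
    exact ⟨p, 0, by rw [map_zero, smul_zero, add_zero]⟩
  | zero => exact ⟨0, 0, by rw [map_zero, smul_zero, add_zero]⟩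
  | add x y _ _ hx hy =>
    obtain ⟨p, q, rfl⟩ := hx
    obtain ⟨p', q', rfl⟩ := hy
    exact ⟨p + p', q + q', by rw [map_add, map_add, smul_add]; abel⟩
  | smul z x _ hx =>
    obtain ⟨p, q, rfl⟩ := hx
    refine ⟨z.re • p - z.im • q, z.im • p + z.re • q, ?_⟩
    rw [map_sub, map_add, map_smul, map_smul, map_smul, map_smul]
    simp only [← Complex.coe_smul]
    conv_lhs => rw [← Complex.re_add_im z]
    have hI : I * I = -1 := Complex.I_mul_I
    match_scalars
    · ring
    · linear_combination (z.im : ℂ) * hI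

instance [FiniteDimensional ℝ g] : FiniteDimensional ℂ (complexSpan g) := by
  obtain ⟨s, hs⟩ := Module.Finite.fg_top (R := ℝ) (M := g)
  have h : complexSpan g = Submodule.span ℂ (inclusion g '' s) := by
    have h1 : Set.range (inclusion g) = (Submodule.span ℝ (inclusion g '' s) : Set WeylAlgebra) := by
      rw [← LieHom.coe_toLinearMap, ← Submodule.map_span, hs, Submodule.map_top]
      rfl
    rw [complexSpan, h1, Submodule.span_span_of_tower]
  rw [h]
  exact FiniteDimensional.span_of_finite ℂ (s.finite_toSet.image _)

variable {g}

theorem lie_mem_complexSpan {x y : WeylAlgebra} (hx : x ∈ complexSpan g) (hy : y ∈ complexSpan g) :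
    ⁅x, y⁆ ∈ complexSpan g := by
  induction hx, hy using Submodule.span_induction₂ with
  | mem_mem x y hx hy =>
    obtain ⟨p, rfl⟩ := hx
    obtain ⟨q, rfl⟩ := hy
    rw [← LieHom.map_lie]
    exact inclusion_mem_complexSpan g _
  | zero_left y _ => rw [zero_lie]; exact Submodule.zero_mem _
  | zero_right x _ => rw [lie_zero]; exact Submodule.zero_mem _
  | add_left x y z _ _ _ hx hy => rw [add_lie]; exact Submodule.add_mem _ hx hy
  | add_right x y z _ _ _ hx hy => rw [lie_add]; exact Submodule.add_mem _ hx hy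
  | smul_left r x y _ _ h =>
    rw [Ring.lie_def, smul_mul_assoc, mul_smul_comm, ← smul_sub]
    exact Submodule.smul_mem _ _ h
  | smul_right r x y _ _ h =>
    rw [Ring.lie_def, smul_mul_assoc, mul_smul_comm, ← smul_sub]
    exact Submodule.smul_mem _ _ h

theorem star_mem_complexSpan {x : WeylAlgebra} (hx : x ∈ complexSpan g) :
    star x ∈ complexSpan g := by
  induction hx using Submodule.span_induction with
  | mem x hx =>
    obtain ⟨p, rfl⟩ := hx
    rw [star_inclusion]
    exact Submodule.neg_mem _ (inclusion_mem_complexSpan g p)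
  | zero => rw [star_zero]; exact Submodule.zero_mem _
  | add x y _ _ hx hy => rw [star_add]; exact Submodule.add_mem _ hx hy
  | smul z x _ hx => rw [star_smul]; exact Submodule.smul_mem _ _ hx

/-- For x = p + iq with p, q in g one has x† = -p + iq, so x† = -x forces iq = 0. Thus g is
recovered from its complex span. -/
theorem mem_range_inclusion {x : WeylAlgebra} (hx : x ∈ complexSpan g) (hs : star x = -x) :
    ∃ p, inclusion g p = x := by
  obtain ⟨p, q, rfl⟩ := mem_complexSpan g hx
  rw [star_add, star_smul, star_inclusion, star_inclusion, Complex.star_def, Complex.conj_I,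
    smul_neg, neg_smul, neg_neg, neg_add, add_right_inj] at hs
  rw [eq_neg_iff_add_eq_zero, ← two_smul ℂ, smul_eq_zero] at hs
  exact ⟨p, by rw [hs.resolve_left two_ne_zero, add_zero]⟩

/-- A subalgebra of skew-hermitian elements is isomorphic to `L` as soon as its complex span agrees
with that of a faithful realization of `L` by skew-hermitian elements. -/
theorem nonempty_lieEquiv {L : Type*} [LieRing L] [LieAlgebra ℝ L] (φ : L →ₗ⁅ℝ⁆ WeylAlgebra)
    (hφ : Function.Injective φ) (hmem : ∀ x, φ x ∈ complexSpan g) (hs : ∀ x, star (φ x) = -φ x)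
    (hle : complexSpan g ≤ complexHull (LinearMap.range (φ : L →ₗ[ℝ] WeylAlgebra))) :
    Nonempty (g ≃ₗ⁅ℝ⁆ L) := by
  have h : (inclusion g).range = φ.range := by
    ext x
    rw [LieHom.mem_range, LieHom.mem_range]
    constructor
    · rintro ⟨p, rfl⟩
      -- With z = 1/2, a skew-hermitian p satisfies zp - (zp)† = p.
      have h1 := hle (inclusion_mem_complexSpan g p) 2⁻¹
      rw [star_smul, star_inclusion, smul_neg, sub_neg_eq_add, ← add_smul] at h1
      have h2 : (2⁻¹ + star 2⁻¹ : ℂ) = 1 := by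
        rw [star_inv₀, star_ofNat]
        norm_num
      rwa [h2, one_smul] at h1
    · rintro ⟨y, rfl⟩
      exact mem_range_inclusion (hmem y) (hs y)
  exact ⟨((LieEquiv.ofInjective _ (inclusion_injective g)).trans
    (LieEquiv.ofEq _ _ (congrArg _ h))).trans (LieEquiv.ofInjective _ hφ).symm⟩

end ComplexSpan

/-! ### Skew-hermitian parts of the homogeneous elements -/

theorem skew_cre (z : ℂ) :
    z • cre - star (z • cre) = schrodingerElement 0 0 0 z.im (-z.re) 0 := by
  have h : z • cre - star (z • cre) = quad 0 0 (-star z) z 0 0 := by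
    rw [star_smul, star_cre, quad]
    module
  rw [h, schrodingerElement]
  congr 1 <;> apply Complex.ext <;> simp

theorem skew_cre_sq (z : ℂ) : z • cre ^ 2 - star (z • cre ^ 2) =
    schrodingerElement (-2 * z.re) (-2 * z.im) (-2 * z.im) 0 0 0 := by
  have h : z • cre ^ 2 - star (z • cre ^ 2) = quad 0 0 0 0 (-star z) z := by
    rw [star_smul, star_cre_pow, quad]
    module
  rw [h, schrodingerElement]
  congr 1 <;> apply Complex.ext <;> simp <;> ring

theorem skew_num (α β z : ℂ) :
    z • (α • (1 : WeylAlgebra) + β • num) - star (z • (α • (1 : WeylAlgebra) + β • num)) =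
      schrodingerElement 0 (-2 * (z * β).im) (2 * (z * β).im) 0 0 ((z * β).im / 2 - (z * α).im) := by
  have h : z • (α • (1 : WeylAlgebra) + β • num) - star (z • (α • (1 : WeylAlgebra) + β • num)) =
      quad (z * α - star (z * α)) (z * β - star (z * β)) 0 0 0 0 := by
    rw [star_smul, star_add, star_smul, star_smul, star_one, star_num, quad, star_mul, star_mul]
    module
  rw [h, schrodingerElement]
  congr 1 <;> apply Complex.ext <;> simp <;> ring

/-! ### The classification -/

theorem lie_ann_cre : ⁅ann, cre⁆ = 1 := by
  rw [Ring.lie_def, ann_mul_cre, add_sub_cancel_left]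

theorem lie_ann_sq_cre_sq :
    ⁅ann ^ 2, cre ^ 2⁆ = (2 : ℂ) • (1 : WeylAlgebra) + (4 : ℂ) • num := by
  have h := lie_quad 0 0 0 0 1 0 0 0 0 0 0 1
  have h1 : quad 0 0 0 0 1 0 = ann ^ 2 := by rw [quad]; module
  have h2 : quad 0 0 0 0 0 1 = cre ^ 2 := by rw [quad]; module
  rw [h1, h2] at h
  rw [h, quad]
  module

section Classification

variable {g : LieSubalgebra ℝ skewWeyl}

/-! ### Elements forced into the complex span -/

theorem lie_freeHamiltonian (c : ℝ) (x : WeylAlgebra) :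
    ⁅(freeHamiltonian c).val, x⁆ = I • ⁅num, x⁆ := by
  change ⁅I • (num + algebraMap ℂ WeylAlgebra c), x⁆ = _
  rw [Ring.lie_def, Ring.lie_def, smul_mul_assoc, mul_smul_comm, ← smul_sub, add_mul, mul_add,
    Algebra.commutes, add_sub_add_right_eq_sub]

theorem num_add_mem {c : ℝ} (hc : freeHamiltonian c ∈ g) :
    num + (c : ℂ) • (1 : WeylAlgebra) ∈ complexSpan g := by
  have h : I • (num + algebraMap ℂ WeylAlgebra c) ∈ complexSpan g :=
    inclusion_mem_complexSpan g ⟨_, hc⟩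
  rwa [Submodule.smul_mem_iff _ Complex.I_ne_zero, Algebra.algebraMap_eq_smul_one] at h

theorem lie_num_mem {c : ℝ} (hc : freeHamiltonian c ∈ g) {x : WeylAlgebra}
    (hx : x ∈ complexSpan g) : ⁅num, x⁆ ∈ complexSpan g := by
  have h := lie_mem_complexSpan (inclusion_mem_complexSpan g ⟨_, hc⟩) hx
  change ⁅(freeHamiltonian c).val, x⁆ ∈ _ at h
  rwa [lie_freeHamiltonian, Submodule.smul_mem_iff _ Complex.I_ne_zero] at h

theorem exists_lie_ne_zero (hna : ¬ IsLieAbelian g) :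
    ∃ x ∈ complexSpan g, ∃ y ∈ complexSpan g, ⁅x, y⁆ ≠ 0 := by
  by_contra! hcon
  refine hna ⟨fun x y => inclusion_injective g ?_⟩
  rw [LieHom.map_lie, map_zero]
  exact hcon _ (inclusion_mem_complexSpan g x) _ (inclusion_mem_complexSpan g y)

theorem ann_mem (h : cre ∈ complexSpan g) : ann ∈ complexSpan g :=
  star_cre ▸ star_mem_complexSpan h

theorem ann_sq_mem (h : cre ^ 2 ∈ complexSpan g) : ann ^ 2 ∈ complexSpan g :=
  star_cre_pow 2 ▸ star_mem_complexSpan h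

/-- Scalars come for free from [a, a†] = 1. In contrast, [a², a†²] yields only 2 + 4N, which is why
membership of 1 is a separate question when a† is absent. -/
theorem one_mem (h : cre ∈ complexSpan g) : 1 ∈ complexSpan g :=
  lie_ann_cre ▸ lie_mem_complexSpan (ann_mem h) h

theorem add_num_mem (h : cre ^ 2 ∈ complexSpan g) :
    (2 : ℂ) • (1 : WeylAlgebra) + (4 : ℂ) • num ∈ complexSpan g :=
  lie_ann_sq_cre_sq ▸ lie_mem_complexSpan (ann_sq_mem h) h

/-- Only N + c is known to lie in the span; scalars are needed to remove c. -/
theorem num_mem {c : ℝ} (hc : freeHamiltonian c ∈ g) (h : 1 ∈ complexSpan g) :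
    num ∈ complexSpan g :=
  ((complexSpan g).add_mem_iff_left (Submodule.smul_mem _ _ h)).mp (num_add_mem hc)

theorem linear_mem (s t r : ℝ) (h : cre ∈ complexSpan g) :
    schrodingerElement 0 0 0 s t r ∈ complexSpan g := by
  have h1 : schrodingerElement 0 0 0 s t r = (-(2 * I * r)) • (1 : WeylAlgebra) +
      (I * s + t) • ann + (I * s - t) • cre := by
    rw [schrodingerElement, quad]
    push_cast
    module
  rw [h1]
  exact Submodule.add_mem _ (Submodule.add_mem _ (Submodule.smul_mem _ _ (one_mem h))
    (Submodule.smul_mem _ _ (ann_mem h))) (Submodule.smul_mem _ _ h)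

theorem quadratic_mem (a b c : ℝ) (h : cre ^ 2 ∈ complexSpan g) :
    schrodingerElement a b c 0 0 0 ∈ complexSpan g := by
  have h1 : schrodingerElement a b c 0 0 0 =
      (-(I / 8) * (b - c)) • ((2 : ℂ) • (1 : WeylAlgebra) + (4 : ℂ) • num) +
      (a / 2 - I / 4 * (b + c)) • ann ^ 2 + (-a / 2 - I / 4 * (b + c)) • cre ^ 2 := by
    rw [schrodingerElement, quad]
    push_cast
    module
  rw [h1]
  exact Submodule.add_mem _ (Submodule.add_mem _ (Submodule.smul_mem _ _ (add_num_mem h))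
    (Submodule.smul_mem _ _ (ann_sq_mem h))) (Submodule.smul_mem _ _ h)

theorem scalar_mem (r : ℝ) (h : 1 ∈ complexSpan g) :
    schrodingerElement 0 0 0 0 0 r ∈ complexSpan g := by
  have h1 : schrodingerElement 0 0 0 0 0 r = (-(2 * I * r)) • (1 : WeylAlgebra) := by
    rw [schrodingerElement, quad]
    push_cast
    module
  rw [h1]
  exact Submodule.smul_mem _ _ h

theorem rotation_mem (w : ℝ) {c : ℝ} (hc : freeHamiltonian c ∈ g) (h : 1 ∈ complexSpan g) :
    schrodingerElement 0 w (-w) 0 0 0 ∈ complexSpan g := by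
  have h1 : schrodingerElement 0 w (-w) 0 0 0 =
      (-(I / 2) * w) • (1 : WeylAlgebra) + (-I * w) • num := by
    rw [schrodingerElement, quad]
    push_cast
    module
  rw [h1]
  exact Submodule.add_mem _ (Submodule.smul_mem _ _ h) (Submodule.smul_mem _ _ (num_mem hc h))

/-! ### The four isomorphism types -/

variable [FiniteDimensional ℝ g]

/-- A criterion for an isomorphism with `L`, in terms of homogeneous elements. -/
theorem nonempty_lieEquiv_of_weights {L : Type*} [LieRing L] [LieAlgebra ℝ L]
    (φ : L →ₗ⁅ℝ⁆ WeylAlgebra) (hφ : Function.Injective φ) (hs : ∀ x, star (φ x) = -φ x)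
    (hmem : ∀ x, φ x ∈ complexSpan g) {c : ℝ} (hc : freeHamiltonian c ∈ g)
    (h12 : cre ∈ complexSpan g ∨ cre ^ 2 ∈ complexSpan g)
    -- The right-hand sides are those of `skew_num`, `skew_cre` and, after reparametrization,
    -- `skew_cre_sq`.
    (h0 : ∀ α β : ℂ, α • (1 : WeylAlgebra) + β • num ∈ complexSpan g → ∀ z : ℂ, ∃ x, φ x =
      schrodingerElement 0 (-2 * (z * β).im) (2 * (z * β).im) 0 0 ((z * β).im / 2 - (z * α).im))
    (h1 : cre ∈ complexSpan g → ∀ s t : ℝ, ∃ x, φ x = schrodingerElement 0 0 0 s t 0)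
    (h2 : cre ^ 2 ∈ complexSpan g → ∀ a b : ℝ, ∃ x, φ x = schrodingerElement a b b 0 0 0) :
    Nonempty (g ≃ₗ⁅ℝ⁆ L) := by
  have hG : ∀ x ∈ complexSpan g, ∀ y ∈ complexSpan g, ⁅x, y⁆ ∈ complexSpan g :=
    fun x hx y hy => lie_mem_complexSpan hx hy
  refine nonempty_lieEquiv φ hφ hmem hs (le_of_weights hG (fun x hx => star_mem_complexSpan hx)
    (fun x hx => lie_num_mem hc hx) (fun x hx => star_mem_complexHull hx) ?_ ?_ ?_)
  · intro h hh z
    obtain ⟨α, β, hαβ⟩ := exists_pol_eq hG h12 hh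
    rw [hαβ] at hh ⊢
    rw [skew_num]
    exact h0 α β hh z
  · intro h z
    rw [skew_cre]
    exact h1 h _ _
  · intro h z
    rw [skew_cre_sq]
    exact h2 h _ _

theorem nonempty_lieEquiv_schrodinger {c : ℝ} (hc : freeHamiltonian c ∈ g)
    (h1 : cre ∈ complexSpan g) (h2 : cre ^ 2 ∈ complexSpan g) :
    Nonempty (g ≃ₗ⁅ℝ⁆ Schrodinger) := by
  have hsurj : ∀ a b d s t r, ∃ x, schrodingerHom x = schrodingerElement a b d s t r :=
    fun a b d s t r => ⟨⟨Heisenberg.mk s t r, SL2.mk a b d⟩, rfl⟩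
  refine nonempty_lieEquiv_of_weights schrodingerHom schrodingerHom_injective
    (fun x => star_schrodingerElement ..) (fun x => ?_) hc (Or.inl h1) (fun _ _ _ _ => hsurj ..)
    (fun _ _ _ => hsurj ..) (fun _ _ _ => hsurj ..)
  have h := Submodule.add_mem _
    (quadratic_mem (x.right.val 0 0) (x.right.val 0 1) (x.right.val 1 0) h2)
    (linear_mem (x.left 0) (x.left 1) (x.left 2) h1)
  rw [← schrodingerElement_add] at h
  simp only [add_zero, zero_add] at h
  exact h

theorem nonempty_lieEquiv_sl2Prod {c : ℝ} (hc : freeHamiltonian c ∈ g)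
    (h1 : cre ∉ complexSpan g) (h2 : cre ^ 2 ∈ complexSpan g) (h : 1 ∈ complexSpan g) :
    Nonempty (g ≃ₗ⁅ℝ⁆ (SL2 × ℝ)) := by
  have hsurj : ∀ a b d r, ∃ x, sl2ProdHom x = schrodingerElement a b d 0 0 r :=
    fun a b d r => ⟨⟨SL2.mk a b d, r⟩, rfl⟩
  refine nonempty_lieEquiv_of_weights sl2ProdHom sl2ProdHom_injective
    (fun x => star_schrodingerElement ..) (fun x => ?_) hc (Or.inr h2) (fun _ _ _ _ => hsurj ..)
    (fun h => absurd h h1) (fun _ _ _ => hsurj ..)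
  have h := Submodule.add_mem _
    (quadratic_mem (x.1.val 0 0) (x.1.val 0 1) (x.1.val 1 0) h2) (scalar_mem x.2 h)
  rw [← schrodingerElement_add] at h
  simp only [add_zero, zero_add] at h
  exact h

theorem nonempty_lieEquiv_sl2 {c : ℝ} (hc : freeHamiltonian c ∈ g)
    (h1 : cre ∉ complexSpan g) (h2 : cre ^ 2 ∈ complexSpan g) (h : 1 ∉ complexSpan g) :
    Nonempty (g ≃ₗ⁅ℝ⁆ SL2) := by
  have hsurj : ∀ a b d, ∃ x, sl2Hom x = schrodingerElement a b d 0 0 0 :=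
    fun a b d => ⟨SL2.mk a b d, rfl⟩
  refine nonempty_lieEquiv_of_weights sl2Hom sl2Hom_injective
    (fun x => star_schrodingerElement ..) (fun x => quadratic_mem _ _ _ h2) hc (Or.inr h2) ?_
    (fun h => absurd h h1) (fun _ _ _ => hsurj ..)
  intro α β hαβ z
  -- Otherwise subtracting β/4 times 2 + 4N leaves a nonzero scalar in the span. The relation makes
  -- the central coordinate vanish.
  have h3 : α = β / 2 := by
    by_contra hne
    have h4 := Submodule.sub_mem _ hαβ (Submodule.smul_mem _ (β / 4) (add_num_mem h2))
    have h5 : α • (1 : WeylAlgebra) + β • num -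
        (β / 4) • ((2 : ℂ) • (1 : WeylAlgebra) + (4 : ℂ) • num) =
        (α - β / 2) • (1 : WeylAlgebra) := by module
    rw [h5, Submodule.smul_mem_iff _ (sub_ne_zero.mpr hne)] at h4
    exact h h4
  have h6 : (z * β).im / 2 - (z * α).im = 0 := by
    rw [h3, ← mul_div_assoc, Complex.div_ofNat_im, sub_self]
  rw [h6]
  exact hsurj ..

theorem nonempty_lieEquiv_wignerHeisenberg {c : ℝ} (hc : freeHamiltonian c ∈ g)
    (h1 : cre ∈ complexSpan g) (h2 : cre ^ 2 ∉ complexSpan g) :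
    Nonempty (g ≃ₗ⁅ℝ⁆ WignerHeisenberg) := by
  have hsurj : ∀ w s t r, ∃ x, wignerHeisenbergHom x =
      schrodingerElement 0 w (-w) s t (r - w / 4) :=
    fun w s t r => ⟨WignerHeisenberg.mk w s t r, rfl⟩
  refine nonempty_lieEquiv_of_weights wignerHeisenbergHom wignerHeisenbergHom_injective
    (fun x => star_schrodingerElement ..) (fun x => ?_) hc (Or.inl h1) ?_ ?_
    (fun h => absurd h h2)
  · have h := Submodule.add_mem _ (rotation_mem (x 0) hc (one_mem h1))
      (linear_mem (x 1) (x 2) (x 3 - x 0 / 4) h1)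
    rw [← schrodingerElement_add] at h
    simp only [add_zero, zero_add] at h
    exact h
  · intro α β _ z
    -- With w = -2 Im(zβ), the shift -w/4 supplies the term Im(zβ)/2, leaving r = -Im(zα).
    obtain ⟨x, hx⟩ := hsurj (-2 * (z * β).im) 0 0 (-(z * α).im)
    refine ⟨x, hx.trans ?_⟩
    congr 1 <;> ring
  · intro _ s t
    obtain ⟨x, hx⟩ := hsurj 0 s t 0
    refine ⟨x, hx.trans ?_⟩
    congr 1 <;> ring

end Classification

end SingleMode
end

theorem mainTheorem3 (g : LieSubalgebra ℝ SingleMode.skewWeyl) [FiniteDimensional ℝ g]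
    (hna : ¬ IsLieAbelian g) (c : ℝ) (hc : SingleMode.freeHamiltonian c ∈ g) :
    Nonempty (g ≃ₗ⁅ℝ⁆ SingleMode.Schrodinger) ∨
    Nonempty (g ≃ₗ⁅ℝ⁆ (SingleMode.SL2 × ℝ)) ∨
    Nonempty (g ≃ₗ⁅ℝ⁆ SingleMode.SL2) ∨
    (Nonempty (g ≃ₗ⁅ℝ⁆ SingleMode.WignerHeisenberg) ∧
      LieAlgebra.IsSolvable SingleMode.WignerHeisenberg) := by
  have h12 := SingleMode.WeylAlgebra.cre_mem_or_cre_sq_mem (G := SingleMode.complexSpan g)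
    (fun x hx y hy => SingleMode.lie_mem_complexSpan hx hy)
    (fun x hx => SingleMode.star_mem_complexSpan hx) (fun x hx => SingleMode.lie_num_mem hc hx)
    (SingleMode.exists_lie_ne_zero hna)
  by_cases h1 : SingleMode.WeylAlgebra.cre ∈ SingleMode.complexSpan g
  · by_cases h2 : SingleMode.WeylAlgebra.cre ^ 2 ∈ SingleMode.complexSpan g
    · exact Or.inl (SingleMode.nonempty_lieEquiv_schrodinger hc h1 h2)
    · exact Or.inr (Or.inr (Or.inr ⟨SingleMode.nonempty_lieEquiv_wignerHeisenberg hc h1 h2,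
        SingleMode.WignerHeisenberg.isSolvable⟩))
  -- Noncommutativity supplies a†² once a† is absent; whether scalars occur then separates 𝔰𝔩(2, ℝ)
  -- ⊕ ℝ from 𝔰𝔩(2, ℝ).
  · have h2 := h12.resolve_left h1
    by_cases h : 1 ∈ SingleMode.complexSpan g
    · exact Or.inr (Or.inl (SingleMode.nonempty_lieEquiv_sl2Prod hc h1 h2 h))
    · exact Or.inr (Or.inr (Or.inl (SingleMode.nonempty_lieEquiv_sl2 hc h1 h2 h)))
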